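/- Let $I=[0,1]$, let $a\in L^1(I)$ be real-valued and, for $\lambda\in\mathbb R$, let $L[\lambda]u=u''+(a+\lambda)u$ on $W^{2,1}(I)=\{u\in C(I): u'\in AC(I)\}$, equations being understood almost everywhere. Consider the boundary conditions $$D:\ u(0)=u(1)=0,\qquad M_1:\ u'(0)=u(1)=0,\qquad M_2:\ u(0)=u'(1)=0 .$$ For $X\in\{D,M_1,M_2\}$, $\lambda$ is an eigenvalue of problem $X$ if $L[\lambda]u=0$ has a solution $u\in W^{2,1}(I)$, $u\not\equiv 0$, satisfying $X$; $L[\lambda]$ is nonresonant for $X$ if $\lambda$ is not an eigenvalue. A Green's function of $L[\lambda]$ with conditions $X$ is a function $G$ on $I\times I$, continuous on $I\times I$ and of class $C^1$ off the diagonal, such that (i) for each $s\in(0,1)$ the function $G(\cdot,s)$ is in $W^{2,1}$ on $[0,s]$ and on $[s,1]$, satisfies $L[\lambda]G(\cdot,s)=0$ a.e. there, and satisfies the boundary conditions $X$; (ii) for each $t\in(0,1)$ the lateral limits $\frac{\partial G}{\partial t}(t^-,t)=\frac{\partial G}{\partial t}(t,t^+)$ and $\frac{\partial G}{\partial t}(t^+,t)=\frac{\partial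 G}{\partial t}(t,t^-)$ exist, and $\frac{\partial G}{\partial t}(t^+,t)-\frac{\partial G}{\partial t}(t^-,t)=1$. Then problems $M_1$ and $M_2$ have least eigenvalues $\lambda_0^{M_1}$ and $\lambda_0^{M_2}$, and the following hold. 1. If $L[\lambda]$ is nonresonant for $D$ and $M_1$, there are unique Green's functions $G_D[\lambda]$, $G_{M_1}[\lambda]$ and a unique solution $r_1[\lambda]$ of $L[\lambda]r=0$, $r(0)=1$, $r(1)=0$. Moreover $r_1[\lambda](t)=-\frac{\partial}{\partial s}G_D[\lambda](t,0)$ for $t\in(0,1]$ (one-sided derivative in $s$), and for all $(t,s)\in I\times I$ $$G_{M_1}[\lambda](t,s)=G_D[\lambda](t,s)+r_1[\lambda](t)\,G_{M_1}[\lambda](0,s),$$ that is, $G_{M_1}[\lambda](t,s)=G_D[\lambda](t,s)-\frac{\partial}{\partial s}G_D[\lambda](t,0)\,G_{M_1}[\lambda](0,s)$, where at $t=0$ the derivative is read as its limit $-1$ as $t\to0^+$. 2. If $L[\lambda]$ is nonresonant for $D$ and $M_2$, there are unique Green's functions $G_D[\lambda]$, $G_{M_2}[\lambda]$ and a unique solution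 $r_2[\lambda]$ of $L[\lambda]r=0$, $r(0)=0$, $r(1)=1$. Moreover $r_2[\lambda](t)=\frac{\partial}{\partial s}G_D[\lambda](t,1)$ for $t\in[0,1)$, and for all $(t,s)\in I\times I$ $$G_{M_2}[\lambda](t,s)=G_D[\lambda](t,s)+r_2[\lambda](t)\,G_{M_2}[\lambda](1,s).$$ 3. For every $\lambda<\lambda_0^{M_1}$, $L[\lambda]$ is nonresonant for $D$ and $M_1$, and $G_{M_1}[\lambda](t,s)<G_D[\lambda](t,s)<0$ for all $(t,s)\in(0,1)\times(0,1)$. 4. For every $\lambda<\lambda_0^{M_2}$, $L[\lambda]$ is nonresonant for $D$ and $M_2$, and $G_{M_2}[\lambda](t,s)<G_D[\lambda](t,s)<0$ for all $(t,s)\in(0,1)\times(0,1)$. -/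

import Mathlib

open Set Filter Topology MeasureTheory

/-- The space `W^{2,1}([c,d])`: functions that are differentiable on `[c,d]` (one-sided at the
end points) and whose derivative is absolutely continuous on `[c,d]`. Only the values of `u` on
`[c,d]` matter. -/
def MemW21 (c d : ℝ) (u : ℝ → ℝ) : Prop :=
  DifferentiableOn ℝ u (Icc c d) ∧
    AbsolutelyContinuousOnInterval (derivWithin u (Icc c d)) c d

/-- `u ∈ W^{2,1}([c,d])` and `L[lam] u = u'' + (a + lam) u = 0` almost everywhere on `[c,d]`. -/
def SolvesHill (a : ℝ → ℝ) (lam c d : ℝ) (u : ℝ → ℝ) : Prop :=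
  MemW21 c d u ∧
    ∀ᵐ t ∂(volume.restrict (Icc c d)),
      deriv (derivWithin u (Icc c d)) t + (a t + lam) * u t = 0

/-- The homogeneous two-point boundary conditions on `[0,1]` that are considered. -/
inductive BoundaryCondition where
  | dirichlet
  | mixed1
  | mixed2

/-- Dirichlet: `u(0) = u(1) = 0`; Mixed 1: `u'(0) = u(1) = 0`; Mixed 2: `u(0) = u'(1) = 0`. -/
def BoundaryCondition.Holds : BoundaryCondition → (ℝ → ℝ) → Prop
  | .dirichlet, u => u 0 = 0 ∧ u 1 = 0
  | .mixed1, u => derivWithin u (Icc 0 1) 0 = 0 ∧ u 1 = 0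
  | .mixed2, u => u 0 = 0 ∧ derivWithin u (Icc 0 1) 1 = 0

/-- `L[lam]` is nonresonant: the homogeneous boundary value problem has only the trivial
solution. -/
def Nonresonant (a : ℝ → ℝ) (lam : ℝ) (bc : BoundaryCondition) : Prop :=
  ∀ u : ℝ → ℝ, SolvesHill a lam 0 1 u → bc.Holds u → ∀ t ∈ Icc (0 : ℝ) 1, u t = 0

/-- The set of (real) eigenvalues: those `lam` for which the homogeneous boundary value problem
`u'' + (a + lam) u = 0` has a solution that is not identically zero on `[0,1]`. -/
def eigenvalueSet (a : ℝ → ℝ) (bc : BoundaryCondition) : Set ℝ :=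
  {lam | ∃ u : ℝ → ℝ, SolvesHill a lam 0 1 u ∧ bc.Holds u ∧ ∃ t ∈ Icc (0 : ℝ) 1, u t ≠ 0}

/-- The first eigenvalue. -/
noncomputable def firstEigenvalue (a : ℝ → ℝ) (bc : BoundaryCondition) : ℝ :=
  sInf (eigenvalueSet a bc)

/-- The partial derivative `∂G/∂t (t,s)` (two-sided; used at interior points `t ≠ s`). -/
noncomputable def partialT (G : ℝ → ℝ → ℝ) (t s : ℝ) : ℝ := deriv (fun τ => G τ s) t

/-- `G` (on the square `[0,1] × [0,1]`) is a Green's function of `L[lam]` with the boundary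
conditions `bc`. As the potential `a` is merely integrable, the differential equation is understood
almost everywhere, so that off the diagonal `G` is asked to be of class `C¹` and, for fixed
`s`, of class `W^{2,1}` in `t` on either side of `s`. -/
structure IsGreenFunction (a : ℝ → ℝ) (lam : ℝ) (bc : BoundaryCondition)
    (G : ℝ → ℝ → ℝ) : Prop where
  continuousOn : ContinuousOn (fun p : ℝ × ℝ => G p.1 p.2) (Icc 0 1 ×ˢ Icc 0 1)
  contDiffOn : ContDiffOn ℝ 1 (fun p : ℝ × ℝ => G p.1 p.2)
    ((Icc 0 1 ×ˢ Icc 0 1) \ {p | p.1 = p.2})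
  solves_left : ∀ s ∈ Ioo (0 : ℝ) 1, SolvesHill a lam 0 s (fun t => G t s)
  solves_right : ∀ s ∈ Ioo (0 : ℝ) 1, SolvesHill a lam s 1 (fun t => G t s)
  boundary : ∀ s ∈ Ioo (0 : ℝ) 1, bc.Holds (fun t => G t s)
  jump : ∀ t ∈ Ioo (0 : ℝ) 1, ∃ l r : ℝ,
    Tendsto (fun τ => partialT G τ t) (𝓝[<] t) (𝓝 l) ∧
    Tendsto (fun s => partialT G t s) (𝓝[>] t) (𝓝 l) ∧
    Tendsto (fun τ => partialT G τ t) (𝓝[>] t) (𝓝 r) ∧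
    Tendsto (fun s => partialT G t s) (𝓝[<] t) (𝓝 r) ∧
    r - l = 1

/-- There is exactly one Green's function, as a function on the square `[0,1] × [0,1]`. -/
def HasUniqueGreenFunction (a : ℝ → ℝ) (lam : ℝ) (bc : BoundaryCondition) : Prop :=
  ∃ G, IsGreenFunction a lam bc G ∧
    ∀ G', IsGreenFunction a lam bc G' →
      ∀ t ∈ Icc (0 : ℝ) 1, ∀ s ∈ Icc (0 : ℝ) 1, G' t s = G t s

/-- `r` is the unique solution (on `[0,1]`) of `L[lam] r = 0`, `r(0) = c₀`, `r(1) = c₁`. -/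
def IsUniqueDirichletSolution (a : ℝ → ℝ) (lam c₀ c₁ : ℝ) (r : ℝ → ℝ) : Prop :=
  (SolvesHill a lam 0 1 r ∧ r 0 = c₀ ∧ r 1 = c₁) ∧
    ∀ r' : ℝ → ℝ, SolvesHill a lam 0 1 r' → r' 0 = c₀ → r' 1 = c₁ →
      ∀ t ∈ Icc (0 : ℝ) 1, r' t = r t

/-! With `A' = a` and `v = u' + A u`, the equation becomes a linear first-order system with
continuous coefficients, so classical theory applies although `a` is only integrable. Its solutions
on any subinterval are spanned by the pair `φ`, `ψ` with data `(1, 0)` and `(0, 1)` at `0`, whose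
Wronskian is `1`. Each boundary problem thereby reduces to a determinant, namely `ψ 1`, `-φ 1` and
`ψ' 1` for `D`, `M₁` and `M₂`. Continuity, the unit jump and the boundary conditions force every
Green's function to be the kernel `p (min t s) * q (max t s) / Δ`; the decompositions and the
derivatives at the corners are then identities in `φ`, `ψ`.

For the first eigenvalues, take the solution with value `1` and derivative `0` at the Neumann end.
It has no zero for very negative `lam` (`ne_zero_of_left`, `ne_zero_of_right`) and some zero for
large `lam` (`le_of_ne_zero`). Zeros are simple, so as `lam` grows the first one can only enter
through the Dirichlet end (`isLeast_sInf_endpoint_zeros`); that parameter is the least eigenvalue,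
and below it the solution is positive.

Quotients by this positive solution are monotone, which fixes the signs of the solutions vanishing
at an end (`pos_of_pos`). Hence `G_D < 0`, while the extra term in each decomposition is a positive
`r` times a negative boundary value of the mixed Green's function. -/

/-- First-order form of `u'' + (a + lam) u = 0` on `[c,d]`, where `A' = a` and
`v = u' + A u` is the quasi-derivative of `u`. -/
def IsQuasiSolution (A : ℝ → ℝ) (lam c d : ℝ) (u v : ℝ → ℝ) : Prop :=
  ∀ t ∈ Icc c d, HasDerivWithinAt u (v t - A t * u t) (Icc c d) t ∧
    HasDerivWithinAt v (A t * (v t - A t * u t) - lam * u t) (Icc c d) t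

/-! ### Algebra of the quasi-derivative system and its Wronskian. -/

namespace IsQuasiSolution

variable {A u v u₁ v₁ u₂ v₂ : ℝ → ℝ} {lam c d : ℝ}

theorem mono {c' d' : ℝ} (h : IsQuasiSolution A lam c d u v) (hc : c ≤ c') (hd : d' ≤ d) :
    IsQuasiSolution A lam c' d' u v := fun t ht =>
  have hs := Icc_subset_Icc hc hd
  ⟨(h t (hs ht)).1.mono hs, (h t (hs ht)).2.mono hs⟩

theorem lincomb (h₁ : IsQuasiSolution A lam c d u₁ v₁) (h₂ : IsQuasiSolution A lam c d u₂ v₂)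
    (α β : ℝ) : IsQuasiSolution A lam c d (fun t => α * u₁ t + β * u₂ t)
      (fun t => α * v₁ t + β * v₂ t) := fun t ht => by
  constructor
  · exact (((h₁ t ht).1.const_mul α).add ((h₂ t ht).1.const_mul β)).congr_deriv (by ring)
  · exact (((h₁ t ht).2.const_mul α).add ((h₂ t ht).2.const_mul β)).congr_deriv (by ring)

theorem congr {u' v' : ℝ → ℝ} (h : IsQuasiSolution A lam c d u v) (hu : EqOn u' u (Icc c d))
    (hv : EqOn v' v (Icc c d)) : IsQuasiSolution A lam c d u' v' := fun t ht => by
  rw [hu ht, hv ht]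
  exact ⟨(h t ht).1.congr hu (hu ht), (h t ht).2.congr hv (hv ht)⟩

theorem continuousOn_fst (h : IsQuasiSolution A lam c d u v) : ContinuousOn u (Icc c d) :=
  fun t ht => (h t ht).1.continuousWithinAt

theorem continuousOn_snd (h : IsQuasiSolution A lam c d u v) : ContinuousOn v (Icc c d) :=
  fun t ht => (h t ht).2.continuousWithinAt

/-- Shifting the primitive of the potential by a constant. -/
theorem shift (h : IsQuasiSolution A lam c d u v) (k : ℝ) :
    IsQuasiSolution (fun t => A t + k) lam c d u (fun t => v t + k * u t) := fun t ht => by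
  constructor
  · exact (h t ht).1.congr_deriv (by ring)
  · exact ((h t ht).2.add ((h t ht).1.const_mul k)).congr_deriv (by ring)

end IsQuasiSolution

theorem eq_of_hasDerivWithinAt_zero {f : ℝ → ℝ} {c d : ℝ}
    (h : ∀ t ∈ Icc c d, HasDerivWithinAt f 0 (Icc c d) t) {s t : ℝ} (hs : s ∈ Icc c d)
    (ht : t ∈ Icc c d) : f s = f t := by
  have := (convex_Icc c d).norm_image_sub_le_of_norm_hasDerivWithin_le (C := 0)
    (fun x hx => h x hx) (by simp) ht hs
  rw [zero_mul, norm_le_zero_iff, sub_eq_zero] at this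
  exact this

theorem monotoneOn_Icc_of_hasDerivWithinAt_nonneg {f f' : ℝ → ℝ} {c d : ℝ}
    (h : ∀ t ∈ Icc c d, HasDerivWithinAt f (f' t) (Icc c d) t)
    (h0 : ∀ t ∈ Icc c d, 0 ≤ f' t) : MonotoneOn f (Icc c d) := by
  refine monotoneOn_of_hasDerivWithinAt_nonneg (f' := f') (convex_Icc c d)
    (fun t ht => (h t ht).continuousWithinAt) (fun t ht => ?_) (fun t ht => ?_)
  · exact (h t (interior_subset ht)).mono interior_subset
  · exact h0 t (interior_subset ht)

theorem strictMonoOn_Icc_of_hasDerivWithinAt_pos {f f' : ℝ → ℝ} {c d : ℝ}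
    (h : ∀ t ∈ Icc c d, HasDerivWithinAt f (f' t) (Icc c d) t)
    (h0 : ∀ t ∈ Icc c d, 0 < f' t) : StrictMonoOn f (Icc c d) := by
  refine strictMonoOn_of_hasDerivWithinAt_pos (f' := f') (convex_Icc c d)
    (fun t ht => (h t ht).continuousWithinAt) (fun t ht => ?_) (fun t ht => ?_)
  · exact (h t (interior_subset ht)).mono interior_subset
  · exact h0 t (interior_subset ht)

/-- The system matrix has trace zero, so the terms of the derivative of the Wronskian cancel. -/
theorem IsQuasiSolution.wronskian_eq {A u₁ v₁ u₂ v₂ : ℝ → ℝ} {lam c d : ℝ}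
    (h₁ : IsQuasiSolution A lam c d u₁ v₁) (h₂ : IsQuasiSolution A lam c d u₂ v₂) {s t : ℝ}
    (hs : s ∈ Icc c d) (ht : t ∈ Icc c d) :
    u₁ s * v₂ s - v₁ s * u₂ s = u₁ t * v₂ t - v₁ t * u₂ t := by
  refine eq_of_hasDerivWithinAt_zero (f := fun t => u₁ t * v₂ t - v₁ t * u₂ t) (fun x hx => ?_) hs ht
  exact (((h₁ x hx).1.mul (h₂ x hx).2).sub ((h₁ x hx).2.mul (h₂ x hx).1)).congr_deriv (by ring)

/-! ### Initial value problems: existence and dependence on the parameter. -/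

theorem abs_max_min_sub_le (R x y : ℝ) :
    |max (-R) (min R x) - max (-R) (min R y)| ≤ |x - y| :=
  (abs_max_sub_max_le_max _ _ _ _).trans (by
    simpa using abs_min_sub_min_le_max R x R y)

theorem abs_max_min_le {R : ℝ} (hR : 0 ≤ R) (x : ℝ) :
    |max (-R) (min R x)| ≤ R ∧ |max (-R) (min R x)| ≤ |x| := by
  constructor
  · grind
  · grind

/-- The matrix of the first-order system has sup-norm at most `1 + 2 K + K² + |lam|`. -/
theorem norm_quasiField_le {K lam b x y : ℝ} (hb : |b| ≤ K) :
    ‖((y - b * x, b * (y - b * x) - lam * x) : ℝ × ℝ)‖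
      ≤ (1 + 2 * K + K ^ 2 + |lam|) * ‖((x, y) : ℝ × ℝ)‖ := by
  have hK : 0 ≤ K := (abs_nonneg b).trans hb
  set N := ‖((x, y) : ℝ × ℝ)‖
  have hx : |x| ≤ N := le_max_left _ _
  have hy : |y| ≤ N := le_max_right _ _
  have hN : 0 ≤ N := norm_nonneg _
  have h1 : |y - b * x| ≤ (1 + K) * N := by
    calc |y - b * x| ≤ |y| + |b * x| := abs_sub _ _
      _ = |y| + |b| * |x| := by rw [abs_mul]
      _ ≤ N + K * N := by gcongr
      _ = _ := by ring
  have h2 : |b * (y - b * x) - lam * x| ≤ (K * (1 + K) + |lam|) * N := by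
    calc |b * (y - b * x) - lam * x| ≤ |b * (y - b * x)| + |lam * x| := abs_sub _ _
      _ = |b| * |y - b * x| + |lam| * |x| := by rw [abs_mul, abs_mul]
      _ ≤ K * ((1 + K) * N) + |lam| * N := by gcongr
      _ = _ := by ring
  refine (max_le (h1.trans ?_) (h2.trans ?_))
  · exact mul_le_mul_of_nonneg_right (by nlinarith [abs_nonneg lam, sq_nonneg K]) hN
  · exact mul_le_mul_of_nonneg_right (by nlinarith [abs_nonneg lam, sq_nonneg K]) hN

/-- Global existence for the initial value problem on `[0,1]`. -/
theorem exists_isQuasiSolution {A : ℝ → ℝ} (hA : ContinuousOn A (Icc 0 1)) (lam x₀ y₀ : ℝ) :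
    ∃ u v : ℝ → ℝ, IsQuasiSolution A lam 0 1 u v ∧ u 0 = x₀ ∧ v 0 = y₀ := by
  obtain ⟨K, hK⟩ := isCompact_Icc.exists_bound_of_continuousOn hA
  have hK0 : 0 ≤ K := (norm_nonneg _).trans (hK 0 (by simp))
  set M : ℝ := 1 + 2 * K + K ^ 2 + |lam| with hM
  have hM0 : 0 ≤ M := by positivity
  -- `R` is the Grönwall bound for a solution on `[0,1]`. Clamping both coordinates to `[-R, R]`
  -- makes the field globally bounded, so Picard–Lindelöf covers the whole interval at once; the
  -- bound then shows that the clamp is never active.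
  set R : ℝ := ‖((x₀, y₀) : ℝ × ℝ)‖ * Real.exp M with hR
  have hR0 : 0 ≤ R := by positivity
  let cl : ℝ → ℝ := fun x => max (-R) (min R x)
  let F : ℝ → ℝ × ℝ → ℝ × ℝ := fun t x =>
    (cl x.2 - A t * cl x.1, A t * (cl x.2 - A t * cl x.1) - lam * cl x.1)
  have hnorm : ∀ t ∈ Icc (0 : ℝ) 1, ∀ x, ‖F t x‖ ≤ M * ‖((cl x.1, cl x.2) : ℝ × ℝ)‖ :=
    fun t ht x => norm_quasiField_le (hK t ht)
  have hPL : IsPicardLindelof F (⟨0, by simp⟩ : Icc (0 : ℝ) 1) ((x₀, y₀) : ℝ × ℝ)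
      ⟨M * R, by positivity⟩ 0 ⟨M * R, by positivity⟩ ⟨M, hM0⟩ := by
    refine ⟨fun t ht => ?_, fun x _ => ?_, fun t ht x _ => ?_, ?_⟩
    · refine LipschitzOnWith.of_dist_le_mul fun x _ y _ => ?_
      rw [dist_eq_norm, dist_eq_norm]
      have h1 := norm_quasiField_le (lam := lam) (x := cl x.1 - cl y.1) (y := cl x.2 - cl y.2)
        (hK t ht)
      have h2 : ‖((cl x.1 - cl y.1, cl x.2 - cl y.2) : ℝ × ℝ)‖ ≤ ‖x - y‖ :=
        max_le_max (abs_max_min_sub_le _ _ _) (abs_max_min_sub_le _ _ _)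
      refine le_trans (le_of_eq ?_) (h1.trans (mul_le_mul_of_nonneg_left h2 hM0))
      congr 1
      ext <;> simp only [F, Prod.fst_sub, Prod.snd_sub] <;> ring
    · simp only [F]; fun_prop
    · refine (hnorm t ht x).trans ?_
      change M * _ ≤ M * R
      gcongr
      exact max_le (abs_max_min_le hR0 _).1 (abs_max_min_le hR0 _).1
    · simp
  obtain ⟨α, hα0, hα⟩ := hPL.exists_eq_forall_mem_Icc_hasDerivWithinAt₀
  have hα0' : α 0 = (x₀, y₀) := hα0
  have hbound : ∀ t ∈ Icc (0 : ℝ) 1, ‖α t‖ ≤ R := by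
    intro t ht
    have := norm_le_gronwallBound_of_norm_deriv_right_le (f := α) (f' := fun t => F t (α t))
      (δ := ‖((x₀, y₀) : ℝ × ℝ)‖) (K := M) (ε := 0) (a := 0) (b := 1)
      (fun t ht => (hα t ht).continuousWithinAt)
      (fun t ht => (hα t (Ico_subset_Icc_self ht)).mono_of_mem_nhdsWithin
        (Icc_mem_nhdsGE_of_mem ht)) (by rw [hα0']) (fun t ht => by
        rw [add_zero]
        refine (hnorm t (Ico_subset_Icc_self ht) _).trans ?_
        gcongr
        exact max_le_max (abs_max_min_le hR0 _).2 (abs_max_min_le hR0 _).2) t ht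
    rw [gronwallBound_ε0] at this
    refine this.trans ?_
    rw [hR]
    gcongr
    nlinarith [ht.2]
  have hcl : ∀ x, |x| ≤ R → cl x = x := fun x hx => by
    rw [abs_le] at hx
    simp only [cl]
    rw [min_eq_right hx.2, max_eq_right hx.1]
  refine ⟨fun t => (α t).1, fun t => (α t).2, fun t ht => ?_, by simp [hα0'], by simp [hα0']⟩
  have h := hα t ht
  have e1 : cl (α t).1 = (α t).1 := hcl _ ((norm_fst_le _).trans (hbound t ht))
  have e2 : cl (α t).2 = (α t).2 := hcl _ ((norm_snd_le _).trans (hbound t ht))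
  have hF : F t (α t) = ((α t).2 - A t * (α t).1,
      A t * ((α t).2 - A t * (α t).1) - lam * (α t).1) := by simp only [F, e1, e2]
  rw [hF] at h
  exact ⟨h.fst, h.snd⟩

/-- Solutions with fixed initial values depend continuously on the spectral parameter, uniformly
on `[0,1]`. -/
theorem quasiSolution_continuous_param {A : ℝ → ℝ} (hA : ContinuousOn A (Icc 0 1))
    {u v : ℝ → ℝ → ℝ} {x₀ y₀ : ℝ} (h : ∀ lam, IsQuasiSolution A lam 0 1 (u lam) (v lam))
    (hu0 : ∀ lam, u lam 0 = x₀) (hv0 : ∀ lam, v lam 0 = y₀) (mu : ℝ) :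
    TendstoUniformlyOn u (u mu) (𝓝 mu) (Icc 0 1) ∧
      TendstoUniformlyOn v (v mu) (𝓝 mu) (Icc 0 1) := by
  obtain ⟨K, hK⟩ := isCompact_Icc.exists_bound_of_continuousOn hA
  have hK0 : 0 ≤ K := (norm_nonneg _).trans (hK 0 (by simp))
  obtain ⟨B, hB⟩ := isCompact_Icc.exists_bound_of_continuousOn (h mu).continuousOn_fst
  have hB0 : 0 ≤ B := (norm_nonneg _).trans (hB 0 (by simp))
  -- One Lipschitz constant for all `lam` within distance `1` of `mu`. The difference of two
  -- solutions starts at `0` and is driven by `(lam - mu) * u mu`.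
  set M : ℝ := 1 + 2 * K + K ^ 2 + (|mu| + 1) with hM
  have hM0 : 0 ≤ M := by positivity
  have key : ∀ lam, |lam - mu| < 1 → ∀ t ∈ Icc (0 : ℝ) 1,
      ‖((u lam t - u mu t, v lam t - v mu t) : ℝ × ℝ)‖ ≤ gronwallBound 0 M (|lam - mu| * B) 1 := by
    intro lam hlam t ht
    have hl : |lam| ≤ |mu| + 1 := by
      have := abs_sub_abs_le_abs_sub lam mu; linarith
    have hd : ∀ t ∈ Icc (0 : ℝ) 1, HasDerivWithinAt
        (fun t => ((u lam t - u mu t, v lam t - v mu t) : ℝ × ℝ))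
        ((v lam t - A t * u lam t) - (v mu t - A t * u mu t),
          (A t * (v lam t - A t * u lam t) - lam * u lam t) -
          (A t * (v mu t - A t * u mu t) - mu * u mu t)) (Icc 0 1) t := fun t ht =>
      ((h lam t ht).1.sub (h mu t ht).1).prodMk ((h lam t ht).2.sub (h mu t ht).2)
    have := norm_le_gronwallBound_of_norm_deriv_right_le
      (δ := 0) (K := M) (ε := |lam - mu| * B) (a := 0) (b := 1)
      (fun t ht => (hd t ht).continuousWithinAt)
      (fun t ht => (hd t (Ico_subset_Icc_self ht)).mono_of_mem_nhdsWithin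
        (Icc_mem_nhdsGE_of_mem ht)) (by simp [hu0, hv0]) (fun t ht => by
        have ht' := Ico_subset_Icc_self ht
        have h1 := norm_quasiField_le (lam := lam) (x := u lam t - u mu t)
          (y := v lam t - v mu t) (hK t ht')
        have h2 : ‖((0, -((lam - mu) * u mu t)) : ℝ × ℝ)‖ ≤ |lam - mu| * B := by
          refine max_le ?_ ?_
          · simp only [norm_zero]; positivity
          · change ‖-((lam - mu) * u mu t)‖ ≤ _
            rw [norm_neg, norm_mul]
            exact mul_le_mul_of_nonneg_left (hB t ht') (abs_nonneg _)
        refine le_trans (le_of_eq ?_) ((norm_add_le _ _).trans (add_le_add (h1.trans ?_) h2))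
        · congr 1
          ext <;> simp only [Prod.mk_add_mk] <;> ring
        · exact mul_le_mul_of_nonneg_right (by rw [hM]; gcongr) (norm_nonneg _)) t ht
    exact this.trans (gronwallBound_mono le_rfl (by positivity) hM0 (by linarith [ht.2]))
  have hlim : Tendsto (fun lam => gronwallBound 0 M (|lam - mu| * B) 1) (𝓝 mu) (𝓝 0) := by
    have : Continuous (fun lam => gronwallBound 0 M (|lam - mu| * B) 1) :=
      (gronwallBound_continuous_ε 0 M 1).comp (by fun_prop)
    simpa [gronwallBound_ε0_δ0] using this.tendsto mu
  have hnear : ∀ᶠ lam in 𝓝 mu, |lam - mu| < 1 := by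
    filter_upwards [Metric.ball_mem_nhds mu one_pos] with lam h using by simpa [Real.dist_eq] using h
  constructor <;> rw [Metric.tendstoUniformlyOn_iff] <;> intro ε hε <;>
    filter_upwards [hnear, hlim.eventually_lt_const hε] with lam h1 h2 t ht <;>
    rw [dist_comm, Real.dist_eq]
  · exact ((norm_fst_le _).trans (key lam h1 t ht)).trans_lt h2
  · exact ((norm_snd_le _).trans (key lam h1 t ht)).trans_lt h2

/-! ### Absence and presence of zeros for extreme parameters. -/

/-- For `lam ≤ -K²` the product of a solution and its quasi-derivative is nondecreasing. -/
theorem IsQuasiSolution.monotoneOn_mul {A u v : ℝ → ℝ} {lam c d K : ℝ}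
    (h : IsQuasiSolution A lam c d u v) (hK : ∀ t ∈ Icc c d, |A t| ≤ K) (hlam : lam ≤ -K ^ 2) :
    MonotoneOn (fun t => u t * v t) (Icc c d) := by
  refine monotoneOn_Icc_of_hasDerivWithinAt_nonneg (fun t ht => (h t ht).1.mul (h t ht).2)
    fun t ht => ?_
  have : A t ^ 2 ≤ K ^ 2 := sq_le_sq' (by linarith [neg_abs_le (A t), hK t ht])
    (le_of_abs_le (hK t ht))
  nlinarith [sq_nonneg (v t), sq_nonneg (u t), mul_nonneg (sub_nonneg.2 (this.trans
    (show K ^ 2 ≤ -lam by linarith))) (sq_nonneg (u t))]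

/-- Since `u v` starts at `0` and is nondecreasing, it stays nonnegative. Then `(u²)' = 2 u v - 2 A
u² ≥ -2 K u²`, so `u² exp (2 K t)` cannot fall from its positive initial value to `0`. -/
theorem IsQuasiSolution.ne_zero_of_left {A u v : ℝ → ℝ} {lam c d K : ℝ}
    (h : IsQuasiSolution A lam c d u v) (hK : ∀ t ∈ Icc c d, |A t| ≤ K) (hlam : lam ≤ -K ^ 2)
    (hu : u c ≠ 0) (hv : v c = 0) : ∀ t ∈ Icc c d, u t ≠ 0 := by
  intro t ht h0
  have hcd : c ≤ d := ht.1.trans ht.2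
  have hc : c ∈ Icc c d := left_mem_Icc.2 hcd
  have hpos : ∀ s ∈ Icc c d, 0 ≤ u s * v s := fun s hs => by
    simpa [hv] using h.monotoneOn_mul hK hlam hc hs hs.1
  have hm : MonotoneOn (fun s => u s * u s * Real.exp (2 * K * s)) (Icc c d) := by
    refine monotoneOn_Icc_of_hasDerivWithinAt_nonneg (fun s hs => ((h s hs).1.mul (h s hs).1).mul
      ((hasDerivAt_id s).const_mul (2 * K)).exp.hasDerivWithinAt) fun s hs => ?_
    have h1 := hpos s hs
    have h2 : 0 ≤ (K - A s) * u s ^ 2 :=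
      mul_nonneg (sub_nonneg.2 (le_of_abs_le (hK s hs))) (sq_nonneg _)
    have h3 := Real.exp_pos (2 * K * s)
    simp only [id]
    have : 0 ≤ Real.exp (2 * K * s) * (2 * (u s * v s) + 2 * ((K - A s) * u s ^ 2)) := by positivity
    simp only [Pi.mul_apply]
    nlinarith
  have := hm hc ht ht.1
  simp only [h0, zero_mul] at this
  have : 0 < u c * u c * Real.exp (2 * K * c) := mul_pos (mul_self_pos.2 hu) (Real.exp_pos _)
  linarith

/-- Mirror image of `ne_zero_of_left`: here `u v ≤ 0`, and `u² exp (-2 K t)` is nonincreasing. -/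
theorem IsQuasiSolution.ne_zero_of_right {A u v : ℝ → ℝ} {lam c d K : ℝ}
    (h : IsQuasiSolution A lam c d u v) (hK : ∀ t ∈ Icc c d, |A t| ≤ K) (hlam : lam ≤ -K ^ 2)
    (hu : u d ≠ 0) (hv : v d = 0) : ∀ t ∈ Icc c d, u t ≠ 0 := by
  intro t ht h0
  have hcd : c ≤ d := ht.1.trans ht.2
  have hd : d ∈ Icc c d := right_mem_Icc.2 hcd
  have hneg : ∀ s ∈ Icc c d, u s * v s ≤ 0 := fun s hs => by
    simpa [hv] using h.monotoneOn_mul hK hlam hs hd hs.2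
  have hm : MonotoneOn (fun s => -(u s * u s * Real.exp (-2 * K * s))) (Icc c d) := by
    refine monotoneOn_Icc_of_hasDerivWithinAt_nonneg (fun s hs => (((h s hs).1.mul (h s hs).1).mul
      ((hasDerivAt_id s).const_mul (-2 * K)).exp.hasDerivWithinAt).neg) fun s hs => ?_
    have h1 := hneg s hs
    have h2 : 0 ≤ (K + A s) * u s ^ 2 :=
      mul_nonneg (by linarith [neg_le_of_abs_le (hK s hs)]) (sq_nonneg _)
    have h3 := Real.exp_pos (-2 * K * s)
    simp only [id]
    have : 0 ≤ Real.exp (-2 * K * s) * (2 * (-(u s * v s)) + 2 * ((K + A s) * u s ^ 2)) :=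
      mul_nonneg h3.le (by linarith)
    simp only [Pi.mul_apply]
    nlinarith
  have := hm ht hd ht.2
  simp only [h0, zero_mul] at this
  have : 0 < u d * u d * Real.exp (-2 * K * d) := mul_pos (mul_self_pos.2 hu) (Real.exp_pos _)
  linarith

/-- A solution without zeros on `[0,1]` forces an upper bound on the spectral parameter. -/
theorem IsQuasiSolution.le_of_ne_zero {A u v : ℝ → ℝ} {lam K : ℝ}
    (h : IsQuasiSolution A lam 0 1 u v) (hK : ∀ t ∈ Icc (0 : ℝ) 1, |A t| ≤ K)
    (hu : ∀ t ∈ Icc (0 : ℝ) 1, u t ≠ 0) : lam ≤ 30 * (1 + 2 * K) := by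
  -- The quotient `g = v / u` satisfies the Riccati equation `g' = -lam - (g - A)²`. It is tested
  -- against `w²` with `w = t (1 - t)`, which kills the boundary terms; the polynomial is the
  -- primitive of `w²`, and `∫ w² = 1/30` gives the constant `30`.
  have hm : MonotoneOn (fun t => (1 + 2 * K) * t - lam * (t ^ 3 / 3 - t ^ 4 / 2 + t ^ 5 / 5)
      - (t * (1 - t)) ^ 2 * (v t / u t)) (Icc (0 : ℝ) 1) := by
    refine monotoneOn_Icc_of_hasDerivWithinAt_nonneg (f' := fun t => (1 + 2 * K)
      - lam * (t * (1 - t)) ^ 2 - (2 * (t * (1 - t)) * (1 - 2 * t) * (v t / u t) +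
        (t * (1 - t)) ^ 2 * (-lam - (v t / u t - A t) ^ 2))) (fun t ht => ?_) fun t ht => ?_
    · have h1 : HasDerivWithinAt (fun t => v t / u t) (-lam - (v t / u t - A t) ^ 2) (Icc 0 1) t := by
        have := hu t ht
        exact ((h t ht).2.div (h t ht).1 this).congr_deriv (by field_simp; ring)
      have h2 : HasDerivAt (fun t : ℝ => (t * (1 - t)) ^ 2) (2 * (t * (1 - t)) * (1 - 2 * t)) t := by
        exact (((hasDerivAt_id t).mul ((hasDerivAt_id t).const_sub 1)).pow 2).congr_deriv (by
          simp only [id, Pi.mul_apply]; ring)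
      have h3 : HasDerivAt (fun t : ℝ => (1 + 2 * K) * t - lam * (t ^ 3 / 3 - t ^ 4 / 2 + t ^ 5 / 5))
          ((1 + 2 * K) - lam * (t * (1 - t)) ^ 2) t := by
        exact (((hasDerivAt_id t).const_mul (1 + 2 * K)).sub
          (((((hasDerivAt_pow 3 t).div_const 3).sub ((hasDerivAt_pow 4 t).div_const 2)).add
            ((hasDerivAt_pow 5 t).div_const 5)).const_mul lam)).congr_deriv (by push_cast; ring)
      exact h3.hasDerivWithinAt.sub (h2.hasDerivWithinAt.mul h1)
    · have hA := abs_le.1 (hK t ht)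
      set g := v t / u t
      set w := t * (1 - t)
      have hw0 : 0 ≤ w := mul_nonneg ht.1 (by linarith [ht.2])
      have hw1 : w ≤ 1 := by nlinarith [ht.1, ht.2]
      have hp : -1 ≤ 1 - 2 * t ∧ 1 - 2 * t ≤ 1 := ⟨by linarith [ht.2], by linarith [ht.1]⟩
      have hp2 : (1 - 2 * t) ^ 2 ≤ 1 := by nlinarith
      have hwA : |w * (1 - 2 * t) * A t| ≤ K := by
        rw [abs_mul, abs_mul]
        have h1 : |w| ≤ 1 := abs_le.2 ⟨by linarith, hw1⟩
        have h2 : |1 - 2 * t| ≤ 1 := abs_le.2 hp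
        calc |w| * |1 - 2 * t| * |A t| ≤ 1 * 1 * K := by
              gcongr; exact hK t ht
          _ = K := by ring
      have := (abs_le.1 hwA).2
      -- Completing the square: `2 w w' g - w² (g - A)² ≤ w'² + 2 w w' A ≤ 1 + 2 K`.
      nlinarith [sq_nonneg (w * (g - A t) - (1 - 2 * t))]
  have := hm (left_mem_Icc.2 zero_le_one) (right_mem_Icc.2 zero_le_one) zero_le_one
  norm_num at this
  linarith

/-! ### Equivalence of `W^{2,1}` solutions and the first-order system. -/

/-- The primitive of the potential used in the quasi-derivative. -/
noncomputable def potentialPrimitive (a : ℝ → ℝ) (t : ℝ) : ℝ := ∫ x in (0 : ℝ)..t, a x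

section Potential

variable {a : ℝ → ℝ} {lam c d : ℝ} {u v : ℝ → ℝ}

theorem absolutelyContinuous_potentialPrimitive (ha : IntegrableOn a (Icc 0 1)) :
    AbsolutelyContinuousOnInterval (potentialPrimitive a) 0 1 :=
  IntervalIntegrable.absolutelyContinuousOnInterval_intervalIntegral
    ((intervalIntegrable_iff_integrableOn_Icc_of_le zero_le_one).2 ha) (by simp)

theorem continuousOn_potentialPrimitive (ha : IntegrableOn a (Icc 0 1)) :
    ContinuousOn (potentialPrimitive a) (Icc 0 1) := by
  simpa using (absolutelyContinuous_potentialPrimitive ha).continuousOn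

theorem ae_hasDerivAt_potentialPrimitive (ha : IntegrableOn a (Icc 0 1)) :
    ∀ᵐ t, t ∈ Icc (0 : ℝ) 1 → HasDerivAt (potentialPrimitive a) (a t) t := by
  filter_upwards [((intervalIntegrable_iff_integrableOn_Icc_of_le
    zero_le_one).2 ha).ae_hasDerivAt_integral] with t h ht
  exact h (by simpa using ht) 0 (by simp)

theorem contDiffOn_one_of_hasDerivWithinAt {f f' : ℝ → ℝ} {c d : ℝ} (hcd : c < d)
    (h : ∀ t ∈ Icc c d, HasDerivWithinAt f (f' t) (Icc c d) t) (hf' : ContinuousOn f' (Icc c d)) :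
    ContDiffOn ℝ 1 f (Icc c d) := by
  rw [contDiffOn_one_iff_derivWithin (uniqueDiffOn_Icc hcd)]
  exact ⟨fun t ht => (h t ht).differentiableWithinAt, hf'.congr fun t ht =>
    (h t ht).derivWithin (uniqueDiffOn_Icc hcd t ht)⟩

theorem IsQuasiSolution.continuousOn_deriv {A : ℝ → ℝ} (hA : ContinuousOn A (Icc c d))
    (h : IsQuasiSolution A lam c d u v) : ContinuousOn (fun t => v t - A t * u t) (Icc c d) :=
  h.continuousOn_snd.sub (hA.mul h.continuousOn_fst)

theorem absolutelyContinuous_of_hasDerivWithinAt {f f' : ℝ → ℝ} {c d : ℝ} (hcd : c < d)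
    (h : ∀ t ∈ Icc c d, HasDerivWithinAt f (f' t) (Icc c d) t) (hf' : ContinuousOn f' (Icc c d)) :
    AbsolutelyContinuousOnInterval f c d :=
  ContDiffOn.absolutelyContinuousOnInterval (by
    rw [uIcc_of_le hcd.le]; exact contDiffOn_one_of_hasDerivWithinAt hcd h hf')

theorem ae_mem_Ioo_of_mem_Icc (c d : ℝ) : ∀ᵐ t : ℝ, t ∈ Icc c d → t ∈ Ioo c d := by
  have h₁ : ∀ᵐ x : ℝ, x ≠ c := by simp [ae_iff, measure_singleton]
  have h₂ : ∀ᵐ x : ℝ, x ≠ d := by simp [ae_iff, measure_singleton]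
  filter_upwards [h₁, h₂] with x h1 h2 hx
  exact ⟨lt_of_le_of_ne hx.1 h1.symm, lt_of_le_of_ne hx.2 h2⟩

/-- An absolutely continuous function whose derivative agrees almost everywhere with a continuous
function is continuously differentiable. -/
theorem AbsolutelyContinuousOnInterval.hasDerivWithinAt_of_ae {f g : ℝ → ℝ} {c d : ℝ} (hcd : c < d)
    (hf : AbsolutelyContinuousOnInterval f c d) (hg : ContinuousOn g (Icc c d))
    (h : ∀ᵐ t, t ∈ Icc c d → HasDerivAt f (g t) t) :
    ∀ t ∈ Icc c d, HasDerivWithinAt f (g t) (Icc c d) t := by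
  set k : ℝ → ℝ := IccExtend hcd.le ((Icc c d).domRestrict g)
  have hk : Continuous k := hg.domRestrict.Icc_extend'
  have hkg : ∀ t ∈ Icc c d, k t = g t := fun t ht => IccExtend_of_mem hcd.le _ ht
  set H : ℝ → ℝ := fun t => ∫ x in c..t, k x
  have hH : ∀ t, HasDerivAt H (k t) t := fun t =>
    (hk.integral_hasStrictDerivAt c t).hasDerivAt
  have hHac : AbsolutelyContinuousOnInterval H c d :=
    absolutelyContinuous_of_hasDerivWithinAt hcd (fun t _ => (hH t).hasDerivWithinAt)
      hk.continuousOn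
  -- Subtracting the integral of `g` leaves an absolutely continuous function with derivative `0`
  -- almost everywhere, hence a constant.
  obtain ⟨C, hC⟩ := (hf.fun_sub hHac).const_of_ae_hasDerivAt_zero (by
    rw [uIcc_of_le hcd.le]
    filter_upwards [h] with t ht htm
    exact ((ht htm).sub (hH t)).congr_deriv (by rw [hkg t htm, sub_self]))
  rw [uIcc_of_le hcd.le] at hC
  intro t ht
  refine ((hH t).hasDerivWithinAt.add_const C).congr (fun s hs => ?_) ?_ |>.congr_deriv (hkg t ht)
  · linarith [hC s hs]
  · linarith [hC t ht]

/-- In `(u' + A u)'` the term `a u` absorbs the singular part of `u''`: almost everywhere the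
derivative equals the continuous function `A u' - lam u`, so it does so everywhere. -/
theorem SolvesHill.exists_isQuasiSolution (ha : IntegrableOn a (Icc 0 1)) (hc : 0 ≤ c)
    (hcd : c < d) (hd : d ≤ 1) (h : SolvesHill a lam c d u) :
    ∃ v, IsQuasiSolution (potentialPrimitive a) lam c d u v := by
  obtain ⟨⟨hdiff, hac⟩, hae⟩ := h
  set A := potentialPrimitive a
  set u' := derivWithin u (Icc c d)
  have hsub : Icc c d ⊆ Icc 0 1 := Icc_subset_Icc hc hd
  have hu : ∀ t ∈ Icc c d, HasDerivWithinAt u (u' t) (Icc c d) t := fun t ht =>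
    (hdiff t ht).hasDerivWithinAt
  have hu'c : ContinuousOn u' (Icc c d) := by simpa [uIcc_of_le hcd.le] using hac.continuousOn
  have huac := absolutelyContinuous_of_hasDerivWithinAt hcd hu hu'c
  have hAac : AbsolutelyContinuousOnInterval A c d :=
    (absolutelyContinuous_potentialPrimitive ha).mono (by
      rwa [uIcc_of_le hcd.le, uIcc_of_le zero_le_one])
  have hAc : ContinuousOn A (Icc c d) := (continuousOn_potentialPrimitive ha).mono hsub
  refine ⟨fun t => u' t + A t * u t, fun t ht => ⟨(hu t ht).congr_deriv (by ring), ?_⟩⟩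
  have := (hac.fun_add (hAac.fun_mul huac)).hasDerivWithinAt_of_ae hcd
    (g := fun t => A t * u' t - lam * u t)
    ((hAc.mul hu'c).sub (continuousOn_const.mul fun t ht => (hu t ht).continuousWithinAt)) (by
    rw [ae_restrict_iff' measurableSet_Icc] at hae
    filter_upwards [hae, hac.ae_differentiableAt, ae_hasDerivAt_potentialPrimitive ha,
      ae_mem_Ioo_of_mem_Icc c d] with t h1 h2 h3 h4 ht
    have hnhds : Icc c d ∈ 𝓝 t := Icc_mem_nhds (h4 ht).1 (h4 ht).2
    have h5 := (h2 (by rwa [uIcc_of_le hcd.le])).hasDerivAt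
    refine (h5.add ((h3 (hsub ht)).mul ((hu t ht).hasDerivAt hnhds))).congr_deriv ?_
    linarith [h1 ht])
  exact (this t ht).congr_deriv (by ring)

/-- The derivative `u' = v - A u` is built from `C¹` functions and the absolutely continuous `A`;
differentiating it almost everywhere brings back `a`. -/
theorem IsQuasiSolution.solvesHill (ha : IntegrableOn a (Icc 0 1)) (hc : 0 ≤ c)
    (hcd : c < d) (hd : d ≤ 1) (h : IsQuasiSolution (potentialPrimitive a) lam c d u v) :
    SolvesHill a lam c d u := by
  set A := potentialPrimitive a
  have hsub : Icc c d ⊆ Icc 0 1 := Icc_subset_Icc hc hd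
  have hAac : AbsolutelyContinuousOnInterval A c d :=
    (absolutelyContinuous_potentialPrimitive ha).mono (by
      rwa [uIcc_of_le hcd.le, uIcc_of_le zero_le_one])
  have hAc : ContinuousOn A (Icc c d) := (continuousOn_potentialPrimitive ha).mono hsub
  have hdw : ∀ t ∈ Icc c d, derivWithin u (Icc c d) t = v t - A t * u t := fun t ht =>
    (h t ht).1.derivWithin (uniqueDiffOn_Icc hcd t ht)
  have hu'c := h.continuousOn_deriv hAc
  have huac := absolutelyContinuous_of_hasDerivWithinAt hcd (fun t ht => (h t ht).1) hu'c
  have hvac := absolutelyContinuous_of_hasDerivWithinAt hcd (fun t ht => (h t ht).2)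
    ((hAc.mul hu'c).sub (continuousOn_const.mul h.continuousOn_fst))
  have hac : AbsolutelyContinuousOnInterval (derivWithin u (Icc c d)) c d := by
    have := hvac.fun_sub (hAac.fun_mul huac)
    -- The two functions agree only on `[c,d]`, so absolute continuity is transferred through its
    -- ε-δ form, which samples no other points.
    rw [absolutelyContinuousOnInterval_iff] at this ⊢
    intro ε hε
    obtain ⟨δ, hδ, H⟩ := this ε hε
    refine ⟨δ, hδ, fun E hE hlt => lt_of_eq_of_lt ?_ (H E hE hlt)⟩
    refine Finset.sum_congr rfl fun i hi => ?_
    have h1 := hE.1 i (by simpa using hi)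
    rw [uIcc_of_le hcd.le] at h1
    rw [hdw _ h1.1, hdw _ h1.2]
  refine ⟨⟨fun t ht => (h t ht).1.differentiableWithinAt, hac⟩, ?_⟩
  rw [ae_restrict_iff' measurableSet_Icc]
  filter_upwards [ae_hasDerivAt_potentialPrimitive ha, ae_mem_Ioo_of_mem_Icc c d] with t h3 h4 ht
  have hnhds : Icc c d ∈ 𝓝 t := Icc_mem_nhds (h4 ht).1 (h4 ht).2
  have hev : derivWithin u (Icc c d) =ᶠ[𝓝 t] fun t => v t - A t * u t := by
    filter_upwards [hnhds] with s hs using hdw s hs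
  have hD : HasDerivAt (fun t => v t - A t * u t) _ t := ((h t ht).2.hasDerivAt hnhds).sub
    ((h3 (hsub ht)).mul ((h t ht).1.hasDerivAt hnhds))
  rw [hev.deriv_eq, hD.deriv]
  ring

end Potential

/-! ### Fundamental pairs, boundary determinants and Green kernels. -/

/-- `φ, ψ` is the fundamental system of `u'' + (a + lam) u = 0` on `[0,1]` normalized at `0`, with
derivatives `φ', ψ'`. -/
structure IsFundamentalPair (a : ℝ → ℝ) (lam : ℝ) (φ φ' ψ ψ' : ℝ → ℝ) : Prop where
  deriv_fst : ∀ t ∈ Icc (0 : ℝ) 1, HasDerivWithinAt φ (φ' t) (Icc 0 1) t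
  deriv_snd : ∀ t ∈ Icc (0 : ℝ) 1, HasDerivWithinAt ψ (ψ' t) (Icc 0 1) t
  cont_fst : ContinuousOn φ' (Icc 0 1)
  cont_snd : ContinuousOn ψ' (Icc 0 1)
  wronskian : ∀ t ∈ Icc (0 : ℝ) 1, φ t * ψ' t - φ' t * ψ t = 1
  fst_zero : φ 0 = 1
  fst_zero' : φ' 0 = 0
  snd_zero : ψ 0 = 0
  snd_zero' : ψ' 0 = 1
  solves_iff : ∀ (c d : ℝ) (u : ℝ → ℝ), 0 ≤ c → c < d → d ≤ 1 →
    (SolvesHill a lam c d u ↔ ∃ α β : ℝ, ∀ t ∈ Icc c d, u t = α * φ t + β * ψ t)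

theorem IsQuasiSolution.isFundamentalPair {a : ℝ → ℝ} (ha : IntegrableOn a (Icc 0 1)) {lam : ℝ}
    {φ v ψ w : ℝ → ℝ} (h₁ : IsQuasiSolution (potentialPrimitive a) lam 0 1 φ v)
    (h₂ : IsQuasiSolution (potentialPrimitive a) lam 0 1 ψ w)
    (hφ : φ 0 = 1) (hv : v 0 = 0) (hψ : ψ 0 = 0) (hw : w 0 = 1) :
    IsFundamentalPair a lam φ (fun t => v t - potentialPrimitive a t * φ t)
      ψ (fun t => w t - potentialPrimitive a t * ψ t) := by
  -- Because `A` vanishes at `0`, derivative and quasi-derivative coincide there.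
  have hA0 : potentialPrimitive a 0 = 0 := by simp [potentialPrimitive]
  have hA := continuousOn_potentialPrimitive ha
  have hW : ∀ t ∈ Icc (0 : ℝ) 1, φ t * w t - v t * ψ t = 1 := fun t ht => by
    rw [h₁.wronskian_eq h₂ ht (left_mem_Icc.2 zero_le_one), hφ, hv, hψ, hw]; ring
  refine ⟨fun t ht => (h₁ t ht).1, fun t ht => (h₂ t ht).1, h₁.continuousOn_deriv hA,
    h₂.continuousOn_deriv hA, fun t ht => ?_, hφ, by simp [hv, hA0], hψ, by simp [hw, hA0],
    fun c d u hc hcd hd => ⟨fun h => ?_, fun h => ?_⟩⟩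
  · linarith [hW t ht]
  · obtain ⟨z, hz⟩ := h.exists_isQuasiSolution ha hc hcd hd
    have hcm : c ∈ Icc c d := left_mem_Icc.2 hcd.le
    -- Cramer's rule: the coefficients are the Wronskians of `u` with `ψ` and, up to sign, with `φ`.
    -- They are constant on `[c,d]`, so they may be evaluated at `c`.
    refine ⟨u c * w c - z c * ψ c, -(u c * v c - z c * φ c), fun t ht => ?_⟩
    rw [hz.wronskian_eq (h₂.mono hc hd) hcm ht, hz.wronskian_eq (h₁.mono hc hd) hcm ht]
    linear_combination (-u t) * hW t ⟨hc.trans ht.1, ht.2.trans hd⟩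
  · obtain ⟨α, β, h⟩ := h
    exact (((h₁.lincomb h₂ α β).mono hc hd).congr h fun _ _ => rfl).solvesHill ha hc hcd hd

namespace BoundaryCondition

/-- Coefficients of the boundary functional at `0` with respect to a fundamental pair. -/
def leftCoeff : BoundaryCondition → ℝ × ℝ
  | dirichlet => (1, 0)
  | mixed1 => (0, 1)
  | mixed2 => (1, 0)

/-- Coefficients of the boundary functional at `1` with respect to a fundamental pair. -/
def rightCoeff (φ φ' ψ ψ' : ℝ → ℝ) : BoundaryCondition → ℝ × ℝ
  | dirichlet => (φ 1, ψ 1)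
  | mixed1 => (φ 1, ψ 1)
  | mixed2 => (φ' 1, ψ' 1)

/-- The determinant of the boundary functionals on a fundamental pair. -/
def charDet (φ φ' ψ ψ' : ℝ → ℝ) (bc : BoundaryCondition) : ℝ :=
  bc.leftCoeff.1 * (bc.rightCoeff φ φ' ψ ψ').2 - bc.leftCoeff.2 * (bc.rightCoeff φ φ' ψ ψ').1

end BoundaryCondition

/-- The Green kernel built from a solution `p` satisfying the left boundary condition and a solution
`q` satisfying the right one. -/
noncomputable def greenKernel (p q : ℝ → ℝ) (Δ t s : ℝ) : ℝ := p (min t s) * q (max t s) / Δ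

theorem greenKernel_of_le {p q : ℝ → ℝ} {Δ t s : ℝ} (h : t ≤ s) :
    greenKernel p q Δ t s = p t * q s / Δ := by simp [greenKernel, h]

theorem greenKernel_of_ge {p q : ℝ → ℝ} {Δ t s : ℝ} (h : s ≤ t) :
    greenKernel p q Δ t s = p s * q t / Δ := by simp [greenKernel, h]

namespace IsFundamentalPair

variable {a : ℝ → ℝ} {lam : ℝ} {φ φ' ψ ψ' : ℝ → ℝ}

theorem hasDerivWithinAt_lincomb (F : IsFundamentalPair a lam φ φ' ψ ψ') (α β : ℝ) :
    ∀ t ∈ Icc (0 : ℝ) 1, HasDerivWithinAt (fun t => α * φ t + β * ψ t) (α * φ' t + β * ψ' t)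
      (Icc 0 1) t := fun t ht =>
  ((F.deriv_fst t ht).const_mul α).add ((F.deriv_snd t ht).const_mul β)

theorem continuousOn_deriv_lincomb (F : IsFundamentalPair a lam φ φ' ψ ψ') (α β : ℝ) :
    ContinuousOn (fun t => α * φ' t + β * ψ' t) (Icc 0 1) :=
  (continuousOn_const.mul F.cont_fst).add (continuousOn_const.mul F.cont_snd)

theorem hasDerivAt_lincomb (F : IsFundamentalPair a lam φ φ' ψ ψ') (α β : ℝ) {t : ℝ}
    (ht : t ∈ Ioo (0 : ℝ) 1) :
    HasDerivAt (fun t => α * φ t + β * ψ t) (α * φ' t + β * ψ' t) t :=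
  (F.hasDerivWithinAt_lincomb α β t (Ioo_subset_Icc_self ht)).hasDerivAt (Icc_mem_nhds ht.1 ht.2)

theorem tendsto_deriv_lincomb (F : IsFundamentalPair a lam φ φ' ψ ψ') (α β : ℝ) {t : ℝ}
    (ht : t ∈ Ioo (0 : ℝ) 1) :
    Tendsto (fun t => α * φ' t + β * ψ' t) (𝓝 t) (𝓝 (α * φ' t + β * ψ' t)) :=
  (F.continuousOn_deriv_lincomb α β).continuousAt (Icc_mem_nhds ht.1 ht.2)

theorem lincomb_eq_zero (F : IsFundamentalPair a lam φ φ' ψ ψ') {α β : ℝ}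
    (h : ∀ t ∈ Icc (0 : ℝ) 1, α * φ t + β * ψ t = 0) : α = 0 ∧ β = 0 := by
  have h0 : (0 : ℝ) ∈ Icc (0 : ℝ) 1 := by simp
  constructor
  · simpa [F.fst_zero, F.snd_zero] using h 0 h0
  · have h1 := F.hasDerivWithinAt_lincomb α β 0 h0
    have h2 : HasDerivWithinAt (fun t => α * φ t + β * ψ t) 0 (Icc 0 1) 0 :=
      (hasDerivWithinAt_const (0 : ℝ) (Icc (0 : ℝ) 1) (0 : ℝ)).congr h (h 0 h0)
    have := (uniqueDiffOn_Icc (zero_lt_one' ℝ) 0 h0).eq_deriv _ h1 h2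
    simpa [F.fst_zero', F.snd_zero'] using this

/-- Boundary conditions in terms of the coefficients near the two end points. -/
theorem holds_iff (F : IsFundamentalPair a lam φ φ' ψ ψ') (bc : BoundaryCondition)
    {u : ℝ → ℝ} {s α β γ δ : ℝ} (hs : s ∈ Ioo (0 : ℝ) 1)
    (h₁ : ∀ t ∈ Icc 0 s, u t = α * φ t + β * ψ t) (h₂ : ∀ t ∈ Icc s 1, u t = γ * φ t + δ * ψ t) :
    bc.Holds u ↔ bc.leftCoeff.1 * α + bc.leftCoeff.2 * β = 0 ∧
      (bc.rightCoeff φ φ' ψ ψ').1 * γ + (bc.rightCoeff φ φ' ψ ψ').2 * δ = 0 := by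
  have m0 : (0 : ℝ) ∈ Icc (0 : ℝ) 1 := by simp
  have m1 : (1 : ℝ) ∈ Icc (0 : ℝ) 1 := by simp
  have u0 : u 0 = α := by simp [h₁ 0 ⟨le_rfl, hs.1.le⟩, F.fst_zero, F.snd_zero]
  have u1 : u 1 = γ * φ 1 + δ * ψ 1 := h₂ 1 ⟨hs.2.le, le_rfl⟩
  have d0 : derivWithin u (Icc 0 1) 0 = β := by
    have : HasDerivWithinAt u (α * φ' 0 + β * ψ' 0) (Icc 0 s) 0 :=
      ((F.hasDerivWithinAt_lincomb α β 0 m0).mono (Icc_subset_Icc_right hs.2.le)).congr h₁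
        (h₁ 0 ⟨le_rfl, hs.1.le⟩)
    have hn : Icc 0 s ∈ 𝓝[Icc 0 1] 0 :=
      mem_nhdsWithin.2 ⟨Iio s, isOpen_Iio, hs.1, fun x hx => ⟨hx.2.1, le_of_lt hx.1⟩⟩
    rw [(this.mono_of_mem_nhdsWithin hn).derivWithin (uniqueDiffOn_Icc zero_lt_one 0 m0),
      F.fst_zero', F.snd_zero']
    ring
  have d1 : derivWithin u (Icc 0 1) 1 = γ * φ' 1 + δ * ψ' 1 := by
    have : HasDerivWithinAt u (γ * φ' 1 + δ * ψ' 1) (Icc s 1) 1 :=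
      ((F.hasDerivWithinAt_lincomb γ δ 1 m1).mono (Icc_subset_Icc_left hs.1.le)).congr h₂
        (h₂ 1 ⟨hs.2.le, le_rfl⟩)
    have hn : Icc s 1 ∈ 𝓝[Icc 0 1] 1 :=
      mem_nhdsWithin.2 ⟨Ioi s, isOpen_Ioi, hs.2, fun x hx => ⟨le_of_lt hx.1, hx.2.2⟩⟩
    exact (this.mono_of_mem_nhdsWithin hn).derivWithin (uniqueDiffOn_Icc zero_lt_one 1 m1)
  cases bc <;> simp [BoundaryCondition.Holds, BoundaryCondition.leftCoeff,
    BoundaryCondition.rightCoeff, u0, u1, d0, d1, mul_comm]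

theorem holds_iff_of_eq (F : IsFundamentalPair a lam φ φ' ψ ψ') (bc : BoundaryCondition)
    {u : ℝ → ℝ} {α β : ℝ} (h : ∀ t ∈ Icc (0 : ℝ) 1, u t = α * φ t + β * ψ t) :
    bc.Holds u ↔ bc.leftCoeff.1 * α + bc.leftCoeff.2 * β = 0 ∧
      (bc.rightCoeff φ φ' ψ ψ').1 * α + (bc.rightCoeff φ φ' ψ ψ').2 * β = 0 :=
  F.holds_iff bc (s := 1 / 2) (by norm_num)
    (fun t ht => h t ⟨ht.1, ht.2.trans (by norm_num)⟩)
    (fun t ht => h t ⟨le_trans (by norm_num) ht.1, ht.2⟩)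

theorem nonresonant_iff (F : IsFundamentalPair a lam φ φ' ψ ψ') (bc : BoundaryCondition) :
    Nonresonant a lam bc ↔ bc.charDet φ φ' ψ ψ' ≠ 0 := by
  constructor
  · intro h hΔ
    -- This combination always meets the left condition; at `1` its boundary functional is `-Δ`.
    have hsol := (F.solves_iff 0 1 (fun t => bc.leftCoeff.2 * φ t + -bc.leftCoeff.1 * ψ t)
      le_rfl zero_lt_one le_rfl).2 ⟨_, _, fun _ _ => rfl⟩
    have := F.lincomb_eq_zero (h _ hsol ((F.holds_iff_of_eq bc fun _ _ => rfl).2 ⟨by ring, by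
      rw [BoundaryCondition.charDet] at hΔ; linarith⟩))
    cases bc <;> simp [BoundaryCondition.leftCoeff] at this
  · intro hΔ u hu hbc t ht
    obtain ⟨α, β, h⟩ := (F.solves_iff 0 1 u le_rfl zero_lt_one le_rfl).1 hu
    obtain ⟨e1, e2⟩ := (F.holds_iff_of_eq bc h).1 hbc
    have hα : bc.charDet φ φ' ψ ψ' * α = 0 := by
      rw [BoundaryCondition.charDet]
      linear_combination (bc.rightCoeff φ φ' ψ ψ').2 * e1 - bc.leftCoeff.2 * e2
    have hβ : bc.charDet φ φ' ψ ψ' * β = 0 := by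
      rw [BoundaryCondition.charDet]
      linear_combination bc.leftCoeff.1 * e2 - (bc.rightCoeff φ φ' ψ ψ').1 * e1
    simp [h t ht, (mul_eq_zero.1 hα).resolve_left hΔ, (mul_eq_zero.1 hβ).resolve_left hΔ]

theorem mem_eigenvalueSet_iff (F : IsFundamentalPair a lam φ φ' ψ ψ') (bc : BoundaryCondition) :
    lam ∈ eigenvalueSet a bc ↔ bc.charDet φ φ' ψ ψ' = 0 := by
  rw [← not_iff_not, ← ne_eq, ← F.nonresonant_iff]
  simp only [eigenvalueSet, Nonresonant, mem_ofPred_eq]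
  push Not
  rfl

/-- The Green kernel of a nonresonant problem in terms of a fundamental pair. -/
theorem isGreenFunction_greenKernel (F : IsFundamentalPair a lam φ φ' ψ ψ')
    (bc : BoundaryCondition) (hΔ : bc.charDet φ φ' ψ ψ' ≠ 0) :
    IsGreenFunction a lam bc (greenKernel
      (fun t => bc.leftCoeff.2 * φ t + -bc.leftCoeff.1 * ψ t)
      (fun t => (bc.rightCoeff φ φ' ψ ψ').2 * φ t + -(bc.rightCoeff φ φ' ψ ψ').1 * ψ t)
      (bc.charDet φ φ' ψ ψ')) := by
  set l := bc.leftCoeff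
  set r := bc.rightCoeff φ φ' ψ ψ'
  set Δ := bc.charDet φ φ' ψ ψ'
  set p : ℝ → ℝ := fun t => l.2 * φ t + -l.1 * ψ t with hp
  set q : ℝ → ℝ := fun t => r.2 * φ t + -r.1 * ψ t with hq
  set p' : ℝ → ℝ := fun t => l.2 * φ' t + -l.1 * ψ' t with hp'
  set q' : ℝ → ℝ := fun t => r.2 * φ' t + -r.1 * ψ' t with hq'
  have hpd := F.hasDerivWithinAt_lincomb l.2 (-l.1)
  have hqd := F.hasDerivWithinAt_lincomb r.2 (-r.1)
  have hpc : ContinuousOn p (Icc 0 1) := fun t ht => (hpd t ht).continuousWithinAt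
  have hqc : ContinuousOn q (Icc 0 1) := fun t ht => (hqd t ht).continuousWithinAt
  have hpC := contDiffOn_one_of_hasDerivWithinAt zero_lt_one hpd
    (F.continuousOn_deriv_lincomb _ _)
  have hqC := contDiffOn_one_of_hasDerivWithinAt zero_lt_one hqd
    (F.continuousOn_deriv_lincomb _ _)
  have hleft : ∀ s t : ℝ, t ∈ Ioo (0 : ℝ) 1 → t < s →
      partialT (greenKernel p q Δ) t s = p' t * q s / Δ := fun s t ht hts => by
    have : HasDerivAt (fun τ => greenKernel p q Δ τ s) (p' t * q s / Δ) t :=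
      (((F.hasDerivAt_lincomb l.2 (-l.1) ht).mul_const (q s)).div_const Δ).congr_of_eventuallyEq
        ((eventually_lt_nhds hts).mono fun τ hτ => greenKernel_of_le hτ.le)
    exact this.deriv
  have hright : ∀ s t : ℝ, t ∈ Ioo (0 : ℝ) 1 → s < t →
      partialT (greenKernel p q Δ) t s = p s * q' t / Δ := fun s t ht hts => by
    have : HasDerivAt (fun τ => greenKernel p q Δ τ s) (p s * q' t / Δ) t :=
      (((F.hasDerivAt_lincomb r.2 (-r.1) ht).const_mul (p s)).div_const Δ).congr_of_eventuallyEq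
        ((eventually_gt_nhds hts).mono fun τ hτ => greenKernel_of_ge hτ.le)
    exact this.deriv
  constructor
  · refine ((hpc.comp (by fun_prop) ?_).mul (hqc.comp (by fun_prop) ?_)).div_const Δ
    · exact fun x hx => ⟨le_min hx.1.1 hx.2.1, (min_le_left _ _).trans hx.1.2⟩
    · exact fun x hx => ⟨hx.1.1.trans (le_max_left _ _), max_le hx.1.2 hx.2.2⟩
  · have e1 : MapsTo Prod.fst ((Icc (0 : ℝ) 1 ×ˢ Icc (0 : ℝ) 1) \ {p : ℝ × ℝ | p.1 = p.2})
      (Icc 0 1) := fun x hx => hx.1.1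
    have e2 : MapsTo Prod.snd ((Icc (0 : ℝ) 1 ×ˢ Icc (0 : ℝ) 1) \ {p : ℝ × ℝ | p.1 = p.2})
      (Icc 0 1) := fun x hx => hx.1.2
    intro x hx
    rcases lt_or_gt_of_ne (show x.1 ≠ x.2 from hx.2) with h | h
    · have h1 := (((hpC.comp contDiff_fst.contDiffOn e1).mul
        (hqC.comp contDiff_snd.contDiffOn e2)).div_const Δ) x hx
      refine h1.congr_of_eventuallyEq (eventually_nhdsWithin_of_eventually_nhds ?_)
        (greenKernel_of_le h.le)
      filter_upwards [(isOpen_lt continuous_fst continuous_snd).mem_nhds h] with y hy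
      exact greenKernel_of_le (le_of_lt hy)
    · have h1 := (((hpC.comp contDiff_snd.contDiffOn e2).mul
        (hqC.comp contDiff_fst.contDiffOn e1)).div_const Δ) x hx
      refine h1.congr_of_eventuallyEq (eventually_nhdsWithin_of_eventually_nhds ?_)
        (greenKernel_of_ge h.le)
      filter_upwards [(isOpen_lt continuous_snd continuous_fst).mem_nhds h] with y hy
      exact greenKernel_of_ge (le_of_lt hy)
  · intro s hs
    exact (F.solves_iff 0 s _ le_rfl hs.1 hs.2.le).2 ⟨l.2 * q s / Δ, -l.1 * q s / Δ,
      fun t ht => by rw [greenKernel_of_le ht.2]; simp only [hp]; ring⟩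
  · intro s hs
    exact (F.solves_iff s 1 _ hs.1.le hs.2 le_rfl).2 ⟨r.2 * p s / Δ, -r.1 * p s / Δ,
      fun t ht => by rw [greenKernel_of_ge ht.1]; simp only [hq]; ring⟩
  · intro s hs
    refine (F.holds_iff bc hs (α := l.2 * q s / Δ) (β := -l.1 * q s / Δ)
      (γ := r.2 * p s / Δ) (δ := -r.1 * p s / Δ) (fun t ht => ?_) fun t ht => ?_).2 ⟨by ring, by ring⟩
    · simp only [greenKernel_of_le ht.2, hp]; ring
    · simp only [greenKernel_of_ge ht.1, hq]; ring
  · intro t ht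
    have hnear : ∀ᶠ τ in 𝓝 t, τ ∈ Ioo (0 : ℝ) 1 := Ioo_mem_nhds ht.1 ht.2
    have hIcc := Icc_mem_nhds ht.1 ht.2
    refine ⟨p' t * q t / Δ, p t * q' t / Δ, ?_, ?_, ?_, ?_, ?_⟩
    · refine Tendsto.congr' ?_ ((((F.tendsto_deriv_lincomb l.2 (-l.1) ht).mul_const
        (q t)).div_const Δ).mono_left nhdsWithin_le_nhds)
      filter_upwards [nhdsWithin_le_nhds hnear, self_mem_nhdsWithin] with τ h1 h2
      exact (hleft t τ h1 h2).symm
    · refine Tendsto.congr' ?_ (((((hqc.continuousAt hIcc).tendsto).const_mul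
        (p' t)).div_const Δ).mono_left nhdsWithin_le_nhds)
      filter_upwards [self_mem_nhdsWithin] with s h2
      exact (hleft s t ht h2).symm
    · refine Tendsto.congr' ?_ ((((F.tendsto_deriv_lincomb r.2 (-r.1) ht).const_mul
        (p t)).div_const Δ).mono_left nhdsWithin_le_nhds)
      filter_upwards [nhdsWithin_le_nhds hnear, self_mem_nhdsWithin] with τ h1 h2
      exact (hright t τ h1 h2).symm
    · refine Tendsto.congr' ?_ (((((hpc.continuousAt hIcc).tendsto).mul_const
        (q' t)).div_const Δ).mono_left nhdsWithin_le_nhds)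
      filter_upwards [self_mem_nhdsWithin] with s h2
      exact (hright s t ht h2).symm
    -- The jump is the Wronskian of `p` and `q` divided by `Δ`, and that Wronskian is exactly `Δ`.
    · rw [← sub_div, div_eq_one_iff_eq hΔ]
      have hW := F.wronskian t (Ioo_subset_Icc_self ht)
      simp only [hp, hq, hp', hq']
      have : Δ = l.1 * r.2 - l.2 * r.1 := rfl
      linear_combination (l.1 * r.2 - l.2 * r.1) * hW - this

/-- Every Green's function of a nonresonant problem is the Green kernel. -/
theorem eq_greenKernel (F : IsFundamentalPair a lam φ φ' ψ ψ')
    (bc : BoundaryCondition) (hΔ : bc.charDet φ φ' ψ ψ' ≠ 0) {G : ℝ → ℝ → ℝ}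
    (hG : IsGreenFunction a lam bc G) : ∀ t ∈ Icc (0 : ℝ) 1, ∀ s ∈ Icc (0 : ℝ) 1,
      G t s = greenKernel (fun t => bc.leftCoeff.2 * φ t + -bc.leftCoeff.1 * ψ t)
      (fun t => (bc.rightCoeff φ φ' ψ ψ').2 * φ t + -(bc.rightCoeff φ φ' ψ ψ').1 * ψ t)
      (bc.charDet φ φ' ψ ψ') t s := by
  have hK := (F.isGreenFunction_greenKernel bc hΔ).continuousOn
  set l := bc.leftCoeff
  set r := bc.rightCoeff φ φ' ψ ψ'
  set Δ := bc.charDet φ φ' ψ ψ'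
  have hΔdef : Δ = l.1 * r.2 - l.2 * r.1 := rfl
  have hint : ∀ t ∈ Icc (0 : ℝ) 1, ∀ s ∈ Ioo (0 : ℝ) 1, G t s =
      greenKernel (fun t => l.2 * φ t + -l.1 * ψ t) (fun t => r.2 * φ t + -r.1 * ψ t) Δ t s := by
    intro t ht s hs
    obtain ⟨α, β, h₁⟩ := (F.solves_iff 0 s _ le_rfl hs.1 hs.2.le).1 (hG.solves_left s hs)
    obtain ⟨γ, δ, h₂⟩ := (F.solves_iff s 1 _ hs.1.le hs.2 le_rfl).1 (hG.solves_right s hs)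
    obtain ⟨e1, e2⟩ := (F.holds_iff bc hs h₁ h₂).1 (hG.boundary s hs)
    change l.1 * α + l.2 * β = 0 at e1
    change r.1 * γ + r.2 * δ = 0 at e2
    obtain ⟨x, y, hx, -, hy, -, hxy⟩ := hG.jump s hs
    have hx' : Tendsto (fun τ => partialT G τ s) (𝓝[<] s) (𝓝 (α * φ' s + β * ψ' s)) := by
      refine Tendsto.congr' ?_ ((F.tendsto_deriv_lincomb α β hs).mono_left nhdsWithin_le_nhds)
      filter_upwards [Ioo_mem_nhdsLT hs.1] with τ hτ
      refine (HasDerivAt.deriv ?_).symm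
      refine (F.hasDerivAt_lincomb α β ⟨hτ.1, hτ.2.trans hs.2⟩).congr_of_eventuallyEq ?_
      filter_upwards [Icc_mem_nhds hτ.1 hτ.2] with z hz using h₁ z hz
    have hy' : Tendsto (fun τ => partialT G τ s) (𝓝[>] s) (𝓝 (γ * φ' s + δ * ψ' s)) := by
      refine Tendsto.congr' ?_ ((F.tendsto_deriv_lincomb γ δ hs).mono_left nhdsWithin_le_nhds)
      filter_upwards [Ioo_mem_nhdsGT hs.2] with τ hτ
      refine (HasDerivAt.deriv ?_).symm
      refine (F.hasDerivAt_lincomb γ δ ⟨hs.1.trans hτ.1, hτ.2⟩).congr_of_eventuallyEq ?_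
      filter_upwards [Icc_mem_nhds hτ.1 hτ.2] with z hz using h₂ z hz
    have hjump : (γ * φ' s + δ * ψ' s) - (α * φ' s + β * ψ' s) = 1 := by
      rw [← tendsto_nhds_unique hx hx', ← tendsto_nhds_unique hy hy', hxy]
    have hcont : α * φ s + β * ψ s = γ * φ s + δ * ψ s := by
      rw [← h₁ s ⟨hs.1.le, le_rfl⟩, ← h₂ s ⟨le_rfl, hs.2.le⟩]
    have hW := F.wronskian s (Ioo_subset_Icc_self hs)
    -- Continuity and the unit jump at `s` form a linear system of determinant `1`: crossing the
    -- diagonal shifts the coefficients by `(-ψ s, φ s)`. The boundary conditions then fix `α` and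
    -- `β`.
    have hγ : γ = α - ψ s := by
      linear_combination (-(γ - α)) * hW - ψ' s * hcont - ψ s * hjump
    have hδ : δ = β + φ s := by
      linear_combination (-(δ - β)) * hW + φ' s * hcont + φ s * hjump
    subst hγ hδ
    have hα : α = l.2 * (r.2 * φ s + -r.1 * ψ s) / Δ := by
      rw [eq_div_iff hΔ, hΔdef]
      linear_combination r.2 * e1 - l.2 * e2
    have hβ : β = -l.1 * (r.2 * φ s + -r.1 * ψ s) / Δ := by
      rw [eq_div_iff hΔ, hΔdef]
      linear_combination (-r.1) * e1 + l.1 * e2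
    rcases le_total t s with h | h
    · rw [greenKernel_of_le h, h₁ t ⟨ht.1, h⟩, hα, hβ]
      ring
    · rw [greenKernel_of_ge h, h₂ t ⟨h, ht.2⟩, hα, hβ]
      field_simp
      rw [hΔdef]
      ring
  intro t ht
  have hmaps : MapsTo (fun s : ℝ => (t, s)) (Icc 0 1) (Icc 0 1 ×ˢ Icc 0 1) :=
    fun s hs => ⟨ht, hs⟩
  -- The defining conditions concern interior `s` only; the edges `s = 0` and `s = 1` follow by
  -- continuity.
  exact EqOn.of_subset_closure (s := Ioo (0 : ℝ) 1) (t := Icc 0 1) (fun s hs => hint t ht s hs)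
    (hG.continuousOn.comp (by fun_prop) hmaps) (hK.comp (by fun_prop) hmaps)
    Ioo_subset_Icc_self (by rw [closure_Ioo (by norm_num)])

theorem hasUniqueGreenFunction (F : IsFundamentalPair a lam φ φ' ψ ψ')
    (bc : BoundaryCondition) (h : Nonresonant a lam bc) : HasUniqueGreenFunction a lam bc :=
  ⟨_, F.isGreenFunction_greenKernel bc ((F.nonresonant_iff bc).1 h),
    fun _ hG => F.eq_greenKernel bc ((F.nonresonant_iff bc).1 h) hG⟩

end IsFundamentalPair

/-! ### Existence of the first eigenvalues and positivity below them. -/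

theorem continuousOn_uncurry_of_tendstoUniformlyOn {f : ℝ → ℝ → ℝ} {s : Set ℝ}
    (hf : ∀ mu, ContinuousOn (f mu) s)
    (h : ∀ mu, TendstoUniformlyOn f (f mu) (𝓝 mu) s) :
    ContinuousOn (fun x : ℝ × ℝ => f x.1 x.2) (univ ×ˢ s) := by
  rintro ⟨mu, t⟩ ⟨-, ht⟩
  refine tendsto_comp_of_locally_uniform_limit_within (F := fun x : ℝ × ℝ => f x.1)
    (g := Prod.snd) (hf mu t ht) ?_ fun U hU => ⟨s, self_mem_nhdsWithin, ?_⟩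
  · exact tendsto_nhdsWithin_of_tendsto_nhds_of_eventually_within _
      (continuousAt_snd.tendsto.mono_left nhdsWithin_le_nhds)
      (eventually_nhdsWithin_of_forall fun x hx => hx.2)
  · have hfst : Tendsto Prod.fst (𝓝[univ ×ˢ s] (mu, t)) (𝓝 mu) :=
      continuousAt_fst.tendsto.mono_left nhdsWithin_le_nhds
    exact hfst.eventually (h mu U hU)

/-- In a family of functions on `[0,1]` with simple zeros, normalized at the end point `e'` and
depending continuously on a parameter, the first parameter at which a zero occurs is the first
parameter at which there is a zero at the other end point `e`. -/
theorem isLeast_sInf_endpoint_zeros {f f' : ℝ → ℝ → ℝ} {e e' b : ℝ}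
    (he : e ∈ Icc (0 : ℝ) 1) (he' : e' ∈ Icc (0 : ℝ) 1)
    (hee : ∀ t ∈ Icc (0 : ℝ) 1, t ∉ Ioo (0 : ℝ) 1 → t ≠ e' → t = e)
    (hd : ∀ lam, ∀ t ∈ Icc (0 : ℝ) 1, HasDerivWithinAt (f lam) (f' lam t) (Icc 0 1) t)
    (hc : ContinuousOn (fun x : ℝ × ℝ => f x.1 x.2) (univ ×ˢ Icc 0 1))
    (hsimple : ∀ lam, ∀ t ∈ Icc (0 : ℝ) 1, f lam t = 0 → f' lam t ≠ 0)
    (hnorm : ∀ lam, f lam e' = 1)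
    (hbdd : ∀ lam ≤ b, ∀ t ∈ Icc (0 : ℝ) 1, f lam t ≠ 0)
    (hne : ∃ lam, ∃ t ∈ Icc (0 : ℝ) 1, f lam t = 0) :
    IsLeast {lam | f lam e = 0} (sInf {lam | f lam e = 0}) ∧
      ∀ lam < sInf {lam | f lam e = 0}, ∀ t ∈ Icc (0 : ℝ) 1, 0 < f lam t := by
  -- Parameters with a zero anywhere on `[0,1]`. The infimum is studied for this larger set first,
  -- and only afterwards is the zero located at `e`.
  set S : Set ℝ := {lam | ∃ t ∈ Icc (0 : ℝ) 1, f lam t = 0} with hS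
  have hSb : BddBelow S := ⟨b, fun lam ⟨t, ht, h0⟩ => by
    by_contra hlt
    exact hbdd lam (not_le.1 hlt).le t ht h0⟩
  set m := sInf S with hm
  have hpos_of_notMem : ∀ lam, lam ∉ S → ∀ t ∈ Icc (0 : ℝ) 1, 0 < f lam t := by
    intro lam hlam t ht
    by_contra hle
    have := isPreconnected_Icc.intermediate_value ht he'
      (fun s hs => (hd lam s hs).continuousWithinAt) (show (0 : ℝ) ∈ Icc _ _ from
        ⟨not_lt.1 hle, by rw [hnorm]; exact zero_le_one⟩)
    obtain ⟨s, hs, h0⟩ := this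
    exact hlam ⟨s, hs, h0⟩
  have hpos : ∀ lam < m, ∀ t ∈ Icc (0 : ℝ) 1, 0 < f lam t := fun lam hlam =>
    hpos_of_notMem lam (notMem_of_lt_csInf hlam hSb)
  -- Otherwise `f m` is positive on `[0,1]`, and by compactness so is `f lam` for all `lam` near
  -- `m`, contradicting the infimum.
  have hmS : m ∈ S := by
    by_contra hmS
    have hev : ∀ᶠ lam in 𝓝 m, ∀ t ∈ Icc (0 : ℝ) 1, t ∈ Icc (0 : ℝ) 1 → 0 < f lam t := by
      refine isCompact_Icc.eventually_forall_of_forall_eventually fun t ht => ?_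
      have h1 := (hc (m, t) ⟨mem_univ _, ht⟩).eventually_const_lt (hpos_of_notMem m hmS t ht)
      filter_upwards [eventually_nhdsWithin_iff.1 h1] with x hx hx2 using hx ⟨mem_univ _, hx2⟩
    obtain ⟨ε, hε, hball⟩ := Metric.eventually_nhds_iff_ball.1 hev
    obtain ⟨lam, hlamS, hlt⟩ := Real.lt_sInf_add_pos (s := S) hne hε
    rw [← hm] at hlt
    have hle : m ≤ lam := csInf_le hSb hlamS
    obtain ⟨t, ht, h0⟩ := hlamS
    have := hball lam (by rw [Metric.mem_ball, Real.dist_eq, abs_lt]; constructor <;> linarith)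
      t ht ht
    linarith
  have hnonneg : ∀ t ∈ Icc (0 : ℝ) 1, 0 ≤ f m t := by
    intro t ht
    have h1 : Tendsto (fun lam => f lam t) (𝓝[<] m) (𝓝 (f m t)) := by
      refine (hc (m, t) ⟨mem_univ _, ht⟩).tendsto.comp (f := fun lam => (lam, t)) ?_
      refine tendsto_nhdsWithin_of_tendsto_nhds_of_eventually_within _ ?_
        (Eventually.of_forall fun _ => ⟨mem_univ _, ht⟩)
      exact (Continuous.tendsto (by fun_prop) m).mono_left nhdsWithin_le_nhds
    refine ge_of_tendsto h1 ?_
    filter_upwards [self_mem_nhdsWithin] with lam hlam using (hpos lam hlam t ht).le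
  have hme : f m e = 0 := by
    obtain ⟨t, ht, h0⟩ := hmS
    -- `f m` is a limit of positive functions, so an interior zero would be a minimum with zero
    -- derivative, against simplicity; the normalization excludes `e'`.
    have hte : t = e := by
      refine hee t ht (fun hto => ?_) fun h => ?_
      · have hnh := Icc_mem_nhds hto.1 hto.2
        have hmin : IsLocalMin (f m) t := by
          filter_upwards [hnh] with s hs
          rw [h0]; exact hnonneg s hs
        exact hsimple m t ht h0 (hmin.hasDerivAt_eq_zero ((hd m t ht).hasDerivAt hnh))
      · rw [h, hnorm] at h0; exact one_ne_zero h0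
    rw [← hte, h0]
  have hleast : IsLeast {lam | f lam e = 0} m :=
    ⟨hme, fun lam hlam => csInf_le hSb ⟨e, he, hlam⟩⟩
  rw [hleast.csInf_eq]
  exact ⟨hleast, hpos⟩

/-- Normalized fundamental pairs for all parameters, the existence of the first eigenvalues of the
mixed problems, and the positivity below them of the solutions that satisfy the Neumann condition
at one end point. -/
theorem exists_fundamentalPairs {a : ℝ → ℝ} (ha : IntegrableOn a (Icc 0 1)) :
    ∃ φ φ' ψ ψ' : ℝ → ℝ → ℝ, (∀ lam, IsFundamentalPair a lam (φ lam) (φ' lam) (ψ lam) (ψ' lam)) ∧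
      (IsLeast (eigenvalueSet a .mixed1) (firstEigenvalue a .mixed1) ∧
        ∀ lam < firstEigenvalue a .mixed1, ∀ t ∈ Icc (0 : ℝ) 1, 0 < φ lam t) ∧
      (IsLeast (eigenvalueSet a .mixed2) (firstEigenvalue a .mixed2) ∧
        ∀ lam < firstEigenvalue a .mixed2, ∀ t ∈ Icc (0 : ℝ) 1,
          0 < ψ' lam 1 * φ lam t + -φ' lam 1 * ψ lam t) := by
  have hA := continuousOn_potentialPrimitive ha
  set A := potentialPrimitive a
  obtain ⟨K, hK⟩ := isCompact_Icc.exists_bound_of_continuousOn hA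
  choose φ v hφ hφ0 hv0 using fun lam => exists_isQuasiSolution hA lam 1 0
  choose ψ w hψ hψ0 hw0 using fun lam => exists_isQuasiSolution hA lam 0 1
  have hF := fun lam => (hφ lam).isFundamentalPair ha (hψ lam) (hφ0 lam) (hv0 lam) (hψ0 lam)
    (hw0 lam)
  have hcφ := quasiSolution_continuous_param hA hφ hφ0 hv0
  have hcψ := quasiSolution_continuous_param hA hψ hψ0 hw0
  have m0 : (0 : ℝ) ∈ Icc (0 : ℝ) 1 := by simp
  have m1 : (1 : ℝ) ∈ Icc (0 : ℝ) 1 := by simp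
  have jφ := continuousOn_uncurry_of_tendstoUniformlyOn (fun lam => (hφ lam).continuousOn_fst)
    fun mu => (hcφ mu).1
  have jψ := continuousOn_uncurry_of_tendstoUniformlyOn (fun lam => (hψ lam).continuousOn_fst)
    fun mu => (hcψ mu).1
  have jv := continuousOn_uncurry_of_tendstoUniformlyOn (fun lam => (hφ lam).continuousOn_snd)
    fun mu => (hcφ mu).2
  have jw := continuousOn_uncurry_of_tendstoUniformlyOn (fun lam => (hψ lam).continuousOn_snd)
    fun mu => (hcψ mu).2
  have hat : ∀ {g : ℝ → ℝ → ℝ}, ContinuousOn (fun x : ℝ × ℝ => g x.1 x.2) (univ ×ˢ Icc 0 1) →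
      ContinuousOn (fun x : ℝ × ℝ => g x.1 1) (univ ×ˢ Icc 0 1) := fun hg =>
    hg.comp (f := fun x : ℝ × ℝ => (x.1, (1 : ℝ))) (by fun_prop) fun x _ => ⟨mem_univ _, m1⟩
  have hex : ∀ {f g : ℝ → ℝ → ℝ}, (∀ lam, IsQuasiSolution A lam 0 1 (f lam) (g lam)) →
      ∃ lam, ∃ t ∈ Icc (0 : ℝ) 1, f lam t = 0 := by
    intro f g h
    by_contra hcon
    push Not at hcon
    have := (h (30 * (1 + 2 * K) + 1)).le_of_ne_zero hK (hcon _)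
    linarith
  refine ⟨φ, fun lam t => v lam t - A t * φ lam t, ψ, fun lam t => w lam t - A t * ψ lam t, hF,
    ?_, ?_⟩
  · have hset : eigenvalueSet a .mixed1 = {lam | φ lam 1 = 0} := by
      ext lam
      rw [(hF lam).mem_eigenvalueSet_iff]
      simp [BoundaryCondition.charDet, BoundaryCondition.leftCoeff, BoundaryCondition.rightCoeff]
    rw [firstEigenvalue, hset]
    refine isLeast_sInf_endpoint_zeros (e' := 0) (b := -K ^ 2) m1 m0 (fun t ht h1 h2 => ?_)
      (fun lam => (hF lam).deriv_fst) jφ (fun lam t ht h0 h0' => ?_) hφ0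
      (fun lam hlam => (hφ lam).ne_zero_of_left hK hlam (by simp [hφ0]) (hv0 lam)) (hex hφ)
    · by_contra h3
      exact h1 ⟨lt_of_le_of_ne ht.1 h2.symm, lt_of_le_of_ne ht.2 h3⟩
    · have := (hF lam).wronskian t ht
      rw [h0', h0] at this
      simp at this
  -- The combination with coefficients `ψ' 1` and `-φ' 1` has value `1` (the Wronskian) and
  -- derivative `0` at `1`. Its value at `0` is `ψ' 1`, the determinant of the problem `M₂`.
  · set α : ℝ → ℝ := fun lam => w lam 1 - A 1 * ψ lam 1
    set β : ℝ → ℝ := fun lam => -(v lam 1 - A 1 * φ lam 1)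
    have hW1 : ∀ lam, α lam * φ lam 1 + β lam * ψ lam 1 = 1 := fun lam => by
      linarith [(hF lam).wronskian 1 m1]
    have hsol := fun lam => (hφ lam).lincomb (hψ lam) (α lam) (β lam)
    have hset : eigenvalueSet a .mixed2 = {lam | α lam * φ lam 0 + β lam * ψ lam 0 = 0} := by
      ext lam
      rw [(hF lam).mem_eigenvalueSet_iff]
      simp [BoundaryCondition.charDet, BoundaryCondition.leftCoeff, BoundaryCondition.rightCoeff,
        hφ0, hψ0, α, A]
    rw [firstEigenvalue, hset]
    refine isLeast_sInf_endpoint_zeros (e' := 1) (b := -(K + K) ^ 2)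
      (f := fun lam t => α lam * φ lam t + β lam * ψ lam t) m0 m1 (fun t ht h1 h2 => ?_)
      (fun lam => (hF lam).hasDerivWithinAt_lincomb (α lam) (β lam)) ?_ (fun lam t ht h0 h0' => ?_)
      hW1 (fun lam hlam => ?_) (hex hsol)
    · by_contra h3
      exact h1 ⟨lt_of_le_of_ne ht.1 (Ne.symm h3), lt_of_le_of_ne ht.2 h2⟩
    · exact (((hat jw).sub (continuousOn_const.mul (hat jψ))).mul jφ).add
        (((hat jv).sub (continuousOn_const.mul (hat jφ))).neg.mul jψ)
    · have hW := (hF lam).wronskian t ht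
      have hα : α lam = 0 := by
        linear_combination (-α lam) * hW + (w lam t - A t * ψ lam t) * h0 - ψ lam t * h0'
      have hβ : β lam = 0 := by
        linear_combination (-β lam) * hW - (v lam t - A t * φ lam t) * h0 + φ lam t * h0'
      have := hW1 lam
      rw [hα, hβ] at this
      simp at this
    -- Replacing `A` by `A - A 1` makes the quasi-derivative at `1` the true derivative, hence zero.
    -- The bound on the primitive doubles, whence `b = -(K + K) ^ 2`.
    · refine ((hsol lam).shift (-A 1)).ne_zero_of_right (K := K + K) (fun t ht => ?_) hlam ?_ ?_
      · exact (abs_add_le _ _).trans (add_le_add (hK t ht) (by rw [abs_neg]; exact hK 1 m1))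
      · rw [hW1]; exact one_ne_zero
      · simp only [α, β]; ring

/-! ### Signs of solutions, explicit Green's functions and decompositions. -/

namespace IsFundamentalPair

variable {a : ℝ → ℝ} {lam : ℝ} {φ φ' ψ ψ' : ℝ → ℝ}

/-- The quotient of two solutions with positive Wronskian is strictly increasing. -/
theorem strictMonoOn_div (F : IsFundamentalPair a lam φ φ' ψ ψ') {α β γ δ : ℝ}
    (hpos : ∀ t ∈ Icc (0 : ℝ) 1, 0 < α * φ t + β * ψ t) (hdet : 0 < α * δ - β * γ) :
    StrictMonoOn (fun t => (γ * φ t + δ * ψ t) / (α * φ t + β * ψ t)) (Icc 0 1) := by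
  refine strictMonoOn_Icc_of_hasDerivWithinAt_pos
    (f' := fun t => (α * δ - β * γ) / (α * φ t + β * ψ t) ^ 2) (fun t ht => ?_)
    fun t ht => div_pos hdet (pow_pos (hpos t ht) 2)
  refine ((F.hasDerivWithinAt_lincomb γ δ t ht).div (F.hasDerivWithinAt_lincomb α β t ht)
    (hpos t ht).ne').congr_deriv ?_
  congr 1
  linear_combination (α * δ - β * γ) * F.wronskian t ht

/-- If some solution is positive on `[0,1]`, so are the solutions vanishing at one end point, up to
sign and except at that end point. -/
theorem pos_of_pos (F : IsFundamentalPair a lam φ φ' ψ ψ') {α β : ℝ}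
    (hpos : ∀ t ∈ Icc (0 : ℝ) 1, 0 < α * φ t + β * ψ t) :
    (∀ t ∈ Ioc (0 : ℝ) 1, 0 < ψ t) ∧ ∀ t ∈ Ico (0 : ℝ) 1, 0 < ψ 1 * φ t - φ 1 * ψ t := by
  have m0 : (0 : ℝ) ∈ Icc (0 : ℝ) 1 := by simp
  have m1 : (1 : ℝ) ∈ Icc (0 : ℝ) 1 := by simp
  have hα : 0 < α := by simpa [F.fst_zero, F.snd_zero] using hpos 0 m0
  constructor
  · intro t ht
    -- The quotient of `ψ` by the positive solution increases from `0`; the determinant is `α`, the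
    -- value of that solution at `0`.
    have := F.strictMonoOn_div (γ := 0) (δ := 1) hpos (by linarith) m0 ⟨ht.1.le, ht.2⟩ ht.1
    simp only [F.snd_zero, zero_mul, one_mul, zero_add, mul_zero, zero_div] at this
    exact (div_pos_iff_of_pos_right (hpos t ⟨ht.1.le, ht.2⟩)).1 this
  · intro t ht
    -- This quotient increases to `0` at `1`, so it is negative before; the determinant is the value
    -- of the positive solution at `1`.
    have := F.strictMonoOn_div (γ := -ψ 1) (δ := φ 1) hpos (by linarith [hpos 1 m1])
      ⟨ht.1, ht.2.le⟩ m1 ht.2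
    have h1 : -ψ 1 * φ 1 + φ 1 * ψ 1 = 0 := by ring
    simp only [h1, zero_div] at this
    have := (div_lt_iff₀ (hpos t ⟨ht.1, ht.2.le⟩)).1 this
    linarith

theorem nonresonant_dirichlet_iff (F : IsFundamentalPair a lam φ φ' ψ ψ') :
    Nonresonant a lam .dirichlet ↔ ψ 1 ≠ 0 := by
  rw [F.nonresonant_iff]
  simp [BoundaryCondition.charDet, BoundaryCondition.leftCoeff, BoundaryCondition.rightCoeff]

theorem nonresonant_mixed1_iff (F : IsFundamentalPair a lam φ φ' ψ ψ') :
    Nonresonant a lam .mixed1 ↔ φ 1 ≠ 0 := by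
  rw [F.nonresonant_iff]
  simp [BoundaryCondition.charDet, BoundaryCondition.leftCoeff, BoundaryCondition.rightCoeff]

theorem nonresonant_mixed2_iff (F : IsFundamentalPair a lam φ φ' ψ ψ') :
    Nonresonant a lam .mixed2 ↔ ψ' 1 ≠ 0 := by
  rw [F.nonresonant_iff]
  simp [BoundaryCondition.charDet, BoundaryCondition.leftCoeff, BoundaryCondition.rightCoeff]

theorem green_dirichlet_eq (F : IsFundamentalPair a lam φ φ' ψ ψ') (h : ψ 1 ≠ 0)
    {G : ℝ → ℝ → ℝ} (hG : IsGreenFunction a lam .dirichlet G) {t s : ℝ}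
    (ht : t ∈ Icc (0 : ℝ) 1) (hs : s ∈ Icc (0 : ℝ) 1) :
    G t s = -(ψ (min t s) * (ψ 1 * φ (max t s) - φ 1 * ψ (max t s)) / ψ 1) := by
  rw [F.eq_greenKernel _ ((F.nonresonant_iff _).1 (F.nonresonant_dirichlet_iff.2 h)) hG t ht s hs]
  simp only [greenKernel, BoundaryCondition.charDet, BoundaryCondition.leftCoeff,
    BoundaryCondition.rightCoeff]
  ring_nf

theorem green_mixed1_eq (F : IsFundamentalPair a lam φ φ' ψ ψ') (h : φ 1 ≠ 0)
    {G : ℝ → ℝ → ℝ} (hG : IsGreenFunction a lam .mixed1 G) {t s : ℝ}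
    (ht : t ∈ Icc (0 : ℝ) 1) (hs : s ∈ Icc (0 : ℝ) 1) :
    G t s = -(φ (min t s) * (ψ 1 * φ (max t s) - φ 1 * ψ (max t s)) / φ 1) := by
  rw [F.eq_greenKernel _ ((F.nonresonant_iff _).1 (F.nonresonant_mixed1_iff.2 h)) hG t ht s hs]
  simp only [greenKernel, BoundaryCondition.charDet, BoundaryCondition.leftCoeff,
    BoundaryCondition.rightCoeff]
  rw [zero_mul, zero_sub, one_mul, div_neg]
  ring_nf

theorem green_mixed2_eq (F : IsFundamentalPair a lam φ φ' ψ ψ') (h : ψ' 1 ≠ 0)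
    {G : ℝ → ℝ → ℝ} (hG : IsGreenFunction a lam .mixed2 G) {t s : ℝ}
    (ht : t ∈ Icc (0 : ℝ) 1) (hs : s ∈ Icc (0 : ℝ) 1) :
    G t s = -(ψ (min t s) * (ψ' 1 * φ (max t s) - φ' 1 * ψ (max t s)) / ψ' 1) := by
  rw [F.eq_greenKernel _ ((F.nonresonant_iff _).1 (F.nonresonant_mixed2_iff.2 h)) hG t ht s hs]
  simp only [greenKernel, BoundaryCondition.charDet, BoundaryCondition.leftCoeff,
    BoundaryCondition.rightCoeff]
  ring_nf

/-- In `t` the unit jumps cancel, so `GM - GD` is a solution vanishing at `1`, hence a multiple of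
`r₁`; its value at `0` is `GM 0 s`. The explicit kernels confirm this on either side of the
diagonal. -/
theorem green_mixed1_decomposition (F : IsFundamentalPair a lam φ φ' ψ ψ') (hψ : ψ 1 ≠ 0)
    (hφ : φ 1 ≠ 0) {GD GM : ℝ → ℝ → ℝ} (hD : IsGreenFunction a lam .dirichlet GD)
    (hM : IsGreenFunction a lam .mixed1 GM) {t s : ℝ}
    (ht : t ∈ Icc (0 : ℝ) 1) (hs : s ∈ Icc (0 : ℝ) 1) :
    GM t s = GD t s + (ψ 1 * φ t + -φ 1 * ψ t) / ψ 1 * GM 0 s := by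
  rw [F.green_dirichlet_eq hψ hD ht hs, F.green_mixed1_eq hφ hM ht hs,
    F.green_mixed1_eq hφ hM (by simp) hs, min_eq_left hs.1, max_eq_right hs.1, F.fst_zero]
  rcases le_total t s with h | h
  · rw [min_eq_left h, max_eq_right h]
    field_simp
    ring
  · rw [min_eq_right h, max_eq_left h]
    field_simp
    ring

theorem green_mixed2_decomposition (F : IsFundamentalPair a lam φ φ' ψ ψ') (hψ : ψ 1 ≠ 0)
    (hψ' : ψ' 1 ≠ 0) {GD GM : ℝ → ℝ → ℝ} (hD : IsGreenFunction a lam .dirichlet GD)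
    (hM : IsGreenFunction a lam .mixed2 GM) {t s : ℝ}
    (ht : t ∈ Icc (0 : ℝ) 1) (hs : s ∈ Icc (0 : ℝ) 1) :
    GM t s = GD t s + (0 * φ t + (1 / ψ 1) * ψ t) * GM 1 s := by
  rw [F.green_dirichlet_eq hψ hD ht hs, F.green_mixed2_eq hψ' hM ht hs,
    F.green_mixed2_eq hψ' hM (by simp) hs, min_eq_right hs.2, max_eq_left hs.2]
  rcases le_total t s with h | h
  · rw [min_eq_left h, max_eq_right h]
    field_simp
    ring
  · rw [min_eq_right h, max_eq_left h]
    field_simp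
    ring

theorem isUniqueDirichletSolution (F : IsFundamentalPair a lam φ φ' ψ ψ') (h : ψ 1 ≠ 0)
    {α β c₀ c₁ : ℝ} (h₀ : α = c₀) (h₁ : α * φ 1 + β * ψ 1 = c₁) :
    IsUniqueDirichletSolution a lam c₀ c₁ (fun t => α * φ t + β * ψ t) := by
  refine ⟨⟨(F.solves_iff 0 1 _ le_rfl zero_lt_one le_rfl).2 ⟨α, β, fun _ _ => rfl⟩, ?_, h₁⟩, ?_⟩
  · simp [F.fst_zero, F.snd_zero, h₀]
  · intro r hr hr0 hr1 t ht
    obtain ⟨γ, δ, hγ⟩ := (F.solves_iff 0 1 r le_rfl zero_lt_one le_rfl).1 hr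
    have e0 : γ = α := by
      rw [h₀, ← hr0, hγ 0 (by simp), F.fst_zero, F.snd_zero]; ring
    have e1 : δ = β := by
      have := hγ 1 (by simp)
      rw [hr1, ← h₁, e0] at this
      exact (mul_right_cancel₀ h (by linarith)).symm
    rw [hγ t ht, e0, e1]

/-- For `s ≤ t` the kernel depends on `s` only through the factor `ψ s`, and `ψ' 0 = 1`. This needs
`t > 0`. -/
theorem green_dirichlet_hasDerivWithinAt_zero (F : IsFundamentalPair a lam φ φ' ψ ψ')
    (h : ψ 1 ≠ 0) {G : ℝ → ℝ → ℝ} (hG : IsGreenFunction a lam .dirichlet G) {t : ℝ}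
    (ht : t ∈ Ioc (0 : ℝ) 1) :
    HasDerivWithinAt (fun s => G t s) (-((ψ 1 * φ t + -φ 1 * ψ t) / ψ 1)) (Icc 0 1) 0 := by
  have m0 : (0 : ℝ) ∈ Icc (0 : ℝ) 1 := by simp
  have ht' : t ∈ Icc (0 : ℝ) 1 := ⟨ht.1.le, ht.2⟩
  have hd := ((F.deriv_snd 0 m0).mul_const (-((ψ 1 * φ t + -φ 1 * ψ t) / ψ 1)))
  rw [F.snd_zero', one_mul] at hd
  have heq : ∀ s ∈ Icc (0 : ℝ) 1, s ≤ t → G t s = ψ s * -((ψ 1 * φ t + -φ 1 * ψ t) / ψ 1) :=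
    fun s hs hst => by
      rw [F.green_dirichlet_eq h hG ht' hs, min_eq_right hst, max_eq_left hst]; ring
  refine hd.congr_of_eventuallyEq ?_ (heq 0 m0 ht.1.le)
  filter_upwards [self_mem_nhdsWithin, nhdsWithin_le_nhds (eventually_lt_nhds ht.1)] with s hs hst
  exact heq s hs hst.le

/-- For `s ≥ t` the factor in `s` is `ψ 1 * φ s - φ 1 * ψ s`, whose derivative at `1` is minus the
Wronskian. -/
theorem green_dirichlet_hasDerivWithinAt_one (F : IsFundamentalPair a lam φ φ' ψ ψ')
    (h : ψ 1 ≠ 0) {G : ℝ → ℝ → ℝ} (hG : IsGreenFunction a lam .dirichlet G) {t : ℝ}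
    (ht : t ∈ Ico (0 : ℝ) 1) :
    HasDerivWithinAt (fun s => G t s) (0 * φ t + (1 / ψ 1) * ψ t) (Icc 0 1) 1 := by
  have m1 : (1 : ℝ) ∈ Icc (0 : ℝ) 1 := by simp
  have ht' : t ∈ Icc (0 : ℝ) 1 := ⟨ht.1, ht.2.le⟩
  have hd := (F.hasDerivWithinAt_lincomb (ψ 1) (-φ 1) 1 m1).mul_const (-(ψ t / ψ 1))
  have hW : ψ 1 * φ' 1 + -φ 1 * ψ' 1 = -1 := by linarith [F.wronskian 1 m1]
  have heq : ∀ s ∈ Icc (0 : ℝ) 1, t ≤ s →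
      G t s = (ψ 1 * φ s + -φ 1 * ψ s) * -(ψ t / ψ 1) := fun s hs hst => by
    rw [F.green_dirichlet_eq h hG ht' hs, min_eq_left hst, max_eq_right hst]; ring
  refine (hd.congr_of_eventuallyEq ?_ (heq 1 m1 ht.2.le)).congr_deriv (by rw [hW]; ring)
  filter_upwards [self_mem_nhdsWithin, nhdsWithin_le_nhds (eventually_gt_nhds ht.2)] with s hs hst
  exact heq s hs hst.le

theorem green_dirichlet_neg (F : IsFundamentalPair a lam φ φ' ψ ψ') {α β : ℝ}
    (hpos : ∀ t ∈ Icc (0 : ℝ) 1, 0 < α * φ t + β * ψ t) {G : ℝ → ℝ → ℝ}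
    (hG : IsGreenFunction a lam .dirichlet G) {t s : ℝ} (ht : t ∈ Ioo (0 : ℝ) 1)
    (hs : s ∈ Ioo (0 : ℝ) 1) : G t s < 0 := by
  obtain ⟨h1, h2⟩ := F.pos_of_pos hpos
  have hψ1 := h1 1 (by simp)
  rw [F.green_dirichlet_eq hψ1.ne' hG (Ioo_subset_Icc_self ht) (Ioo_subset_Icc_self hs)]
  have h3 := h1 (min t s) ⟨lt_min ht.1 hs.1, (min_le_left _ _).trans ht.2.le⟩
  have h4 := h2 (max t s) ⟨ht.1.le.trans (le_max_left _ _), max_lt ht.2 hs.2⟩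
  exact neg_neg_of_pos (div_pos (mul_pos h3 h4) hψ1)

end IsFundamentalPair

theorem mainTheorem4 (a : ℝ → ℝ) (ha : IntegrableOn a (Icc 0 1)) :
    -- the first eigenvalues of the two mixed problems exist
    IsLeast (eigenvalueSet a .mixed1) (firstEigenvalue a .mixed1) ∧
    IsLeast (eigenvalueSet a .mixed2) (firstEigenvalue a .mixed2) ∧
    -- the decomposition identity for Mixed 1
    (∀ lam : ℝ, Nonresonant a lam .dirichlet → Nonresonant a lam .mixed1 →
      HasUniqueGreenFunction a lam .dirichlet ∧ HasUniqueGreenFunction a lam .mixed1 ∧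
      ∃ r₁ : ℝ → ℝ, IsUniqueDirichletSolution a lam 1 0 r₁ ∧
        ∀ GD GM1 : ℝ → ℝ → ℝ, IsGreenFunction a lam .dirichlet GD →
          IsGreenFunction a lam .mixed1 GM1 →
          (∀ t ∈ Ioc (0 : ℝ) 1,
            HasDerivWithinAt (fun s => GD t s) (-(r₁ t)) (Icc 0 1) 0) ∧
          ∀ t ∈ Icc (0 : ℝ) 1, ∀ s ∈ Icc (0 : ℝ) 1,
            GM1 t s = GD t s + r₁ t * GM1 0 s) ∧
    -- the decomposition identity for Mixed 2
    (∀ lam : ℝ, Nonresonant a lam .dirichlet → Nonresonant a lam .mixed2 →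
      HasUniqueGreenFunction a lam .dirichlet ∧ HasUniqueGreenFunction a lam .mixed2 ∧
      ∃ r₂ : ℝ → ℝ, IsUniqueDirichletSolution a lam 0 1 r₂ ∧
        ∀ GD GM2 : ℝ → ℝ → ℝ, IsGreenFunction a lam .dirichlet GD →
          IsGreenFunction a lam .mixed2 GM2 →
          (∀ t ∈ Ico (0 : ℝ) 1,
            HasDerivWithinAt (fun s => GD t s) (r₂ t) (Icc 0 1) 1) ∧
          ∀ t ∈ Icc (0 : ℝ) 1, ∀ s ∈ Icc (0 : ℝ) 1,
            GM2 t s = GD t s + r₂ t * GM2 1 s) ∧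
    -- the comparison for Mixed 1
    (∀ lam < firstEigenvalue a .mixed1,
      Nonresonant a lam .dirichlet ∧ Nonresonant a lam .mixed1 ∧
      ∀ GD GM1 : ℝ → ℝ → ℝ, IsGreenFunction a lam .dirichlet GD →
        IsGreenFunction a lam .mixed1 GM1 →
        ∀ t ∈ Ioo (0 : ℝ) 1, ∀ s ∈ Ioo (0 : ℝ) 1, GM1 t s < GD t s ∧ GD t s < 0) ∧
    -- the comparison for Mixed 2
    (∀ lam < firstEigenvalue a .mixed2,
      Nonresonant a lam .dirichlet ∧ Nonresonant a lam .mixed2 ∧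
      ∀ GD GM2 : ℝ → ℝ → ℝ, IsGreenFunction a lam .dirichlet GD →
        IsGreenFunction a lam .mixed2 GM2 →
        ∀ t ∈ Ioo (0 : ℝ) 1, ∀ s ∈ Ioo (0 : ℝ) 1, GM2 t s < GD t s ∧ GD t s < 0) := by

  obtain ⟨φ, φ', ψ, ψ', F, ⟨hl1, hp1⟩, hl2, hp2⟩ := exists_fundamentalPairs ha
  have m1 : (1 : ℝ) ∈ Icc (0 : ℝ) 1 := by simp
  refine ⟨hl1, hl2, fun lam hD hM => ?_, fun lam hD hM => ?_, fun lam hlam => ?_,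
    fun lam hlam => ?_⟩
  · have hψ := (F lam).nonresonant_dirichlet_iff.1 hD
    have hφ := (F lam).nonresonant_mixed1_iff.1 hM
    have hr : ∀ t, 1 * φ lam t + -φ lam 1 / ψ lam 1 * ψ lam t =
        (ψ lam 1 * φ lam t + -φ lam 1 * ψ lam t) / ψ lam 1 := fun t => by field_simp
    refine ⟨(F lam).hasUniqueGreenFunction _ hD, (F lam).hasUniqueGreenFunction _ hM,
      fun t => 1 * φ lam t + -φ lam 1 / ψ lam 1 * ψ lam t,
      (F lam).isUniqueDirichletSolution hψ rfl (by field_simp; ring), fun GD GM hGD hGM =>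
      ⟨fun t ht => ?_, fun t ht s hs => ?_⟩⟩
    · beta_reduce
      rw [hr]
      exact (F lam).green_dirichlet_hasDerivWithinAt_zero hψ hGD ht
    · beta_reduce
      rw [hr]
      exact (F lam).green_mixed1_decomposition hψ hφ hGD hGM ht hs
  · have hψ := (F lam).nonresonant_dirichlet_iff.1 hD
    have hψ' := (F lam).nonresonant_mixed2_iff.1 hM
    exact ⟨(F lam).hasUniqueGreenFunction _ hD, (F lam).hasUniqueGreenFunction _ hM, _,
      (F lam).isUniqueDirichletSolution hψ rfl (by field_simp; ring), fun GD GM hGD hGM =>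
      ⟨fun t ht => (F lam).green_dirichlet_hasDerivWithinAt_one hψ hGD ht,
        fun t ht s hs => (F lam).green_mixed2_decomposition hψ hψ' hGD hGM ht hs⟩⟩
  -- Here `φ` itself is the positive solution. Its positivity also forces `ψ 1 > 0`, so nonresonance
  -- for `D` needs no comparison of eigenvalues.
  · have hpos : ∀ t ∈ Icc (0 : ℝ) 1, 0 < 1 * φ lam t + 0 * ψ lam t := fun t ht => by
      simpa using hp1 lam hlam t ht
    obtain ⟨h1, h2⟩ := (F lam).pos_of_pos hpos
    have hψ := h1 1 (by simp)
    have hφ := hp1 lam hlam 1 m1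
    refine ⟨(F lam).nonresonant_dirichlet_iff.2 hψ.ne', (F lam).nonresonant_mixed1_iff.2 hφ.ne',
      fun GD GM hGD hGM t ht s hs => ⟨?_, (F lam).green_dirichlet_neg hpos hGD ht hs⟩⟩
    rw [(F lam).green_mixed1_decomposition hψ.ne' hφ.ne' hGD hGM (Ioo_subset_Icc_self ht)
      (Ioo_subset_Icc_self hs), add_lt_iff_neg_left]
    refine mul_neg_of_pos_of_neg (div_pos ?_ hψ) ?_
    · linarith [h2 t ⟨ht.1.le, ht.2⟩]
    · rw [(F lam).green_mixed1_eq hφ.ne' hGM (by simp) (Ioo_subset_Icc_self hs),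
        min_eq_left hs.1.le, max_eq_right hs.1.le, (F lam).fst_zero, one_mul]
      exact neg_neg_of_pos (div_pos (h2 s ⟨hs.1.le, hs.2⟩) hφ)
  · have hpos := hp2 lam hlam
    obtain ⟨h1, h2⟩ := (F lam).pos_of_pos hpos
    have hψ := h1 1 (by simp)
    have hψ' : 0 < ψ' lam 1 := by
      simpa [(F lam).fst_zero, (F lam).snd_zero] using hpos 0 (by simp)
    refine ⟨(F lam).nonresonant_dirichlet_iff.2 hψ.ne', (F lam).nonresonant_mixed2_iff.2 hψ'.ne',
      fun GD GM hGD hGM t ht s hs => ⟨?_, (F lam).green_dirichlet_neg hpos hGD ht hs⟩⟩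
    rw [(F lam).green_mixed2_decomposition hψ.ne' hψ'.ne' hGD hGM (Ioo_subset_Icc_self ht)
      (Ioo_subset_Icc_self hs), add_lt_iff_neg_left]
    refine mul_neg_of_pos_of_neg ?_ ?_
    · rw [zero_mul, zero_add]
      exact mul_pos (one_div_pos.2 hψ) (h1 t ⟨ht.1, ht.2.le⟩)
    · rw [(F lam).green_mixed2_eq hψ'.ne' hGM m1 (Ioo_subset_Icc_self hs),
        min_eq_right hs.2.le, max_eq_left hs.2.le]
      have h3 := hpos 1 m1
      exact neg_neg_of_pos (div_pos (mul_pos (h1 s ⟨hs.1, hs.2.le⟩) (by linarith)) hψ')
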